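/- Let $f=(f_1,\dots,f_n)$ with $f_i\in\mathbb R[x,u]$, $x\in\mathbb R^n$, $u\in\mathbb R^m$, and let $X=\{x\in\mathbb R^n: g_{X,i}(x)\ge 0,\ i=1,\dots,n_X\}$ and $U=\{u\in\mathbb R^m: g_{U,i}(u)\ge 0,\ i=1,\dots,n_U\}$ with polynomials $g_{X,i}\in\mathbb R[x]$, $g_{U,i}\in\mathbb R[u]$, where one of the $g_{X,i}$ is $R_X^2-\|x\|_2^2$ and one of the $g_{U,i}$ is $R_U^2-\|u\|_2^2$ for real constants $R_X,R_U$. Let $\lambda$ be Lebesgue measure on $\mathbb R^n$. Fix a discount factor, $\alpha\in(0,1)$ in discrete time and $\beta>0$ in continuous time, and put $$\mathcal A v(x,u)=v(x)-\alpha v(f(x,u))\ \text{(discrete time)},\qquad \mathcal A v(x,u)=\beta v(x)-\operatorname{grad} v(x)\cdot f(x,u)\ \text{(continuous time)}.$$ Let $\mathcal V$ be $C(\mathbb R^n)$ in discrete time and $C^1(\mathbb R^n)$ in continuous time. Infinite-dimensional LPs. Let $p^*$ be the supremum of $\mu_0(X)$ over finite nonnegative Borel measures $\mu$ supported in $X\times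 U$ and $\mu_0,\hat\mu_0$ supported in $X$ such that $\int\mathcal A v\,d\mu=\int v\,d\mu_0$ for all $v\in\mathcal V$ and $\int w\,d\mu_0+\int w\,d\hat\mu_0=\int_X w\,d\lambda$ for all $w\in C(X)$. Let $d^*$ be the infimum of $\int_X w\,d\lambda$ over $v\in\mathcal V$, $w\in C(X)$ with $\mathcal A v\ge 0$ on $X\times U$, and $w\ge v+1$ and $w\ge 0$ on $X$. Finite-dimensional problems. Let $r_1\le r_2\le\cdots$ be integers with $r_k\ge k$ (for instance $r_k=k$, or $r_k$ so large that $\deg\mathcal A v\le 2r_k$ whenever $\deg v\le 2k$). For $k\ge1$ let $p_k^*$ be the supremum of $(y_0)_0$ over real sequences $y$ (indexed by the monomials in $(x,u)$ of degree $\le 2r_k$) and $y_0,\hat y_0$ (indexed by the monomials in $x$ of degree $\le 2k$) such that, with $L_y(\sum_a p_a z^a)=\sum_a p_a y_a$, * $L_y(\mathcal A v)=L_{y_0}(v)$ for all polynomials $v\in\mathbb R[x]$ with $\deg v\le 2k$ and $\deg\mathcal A v\le 2r_k$; * $L_{y_0}(w)+L_{\hat y_0}(w)=\int_X w\,d\lambda$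 for all polynomials $w\in\mathbb R[x]$ with $\deg w\le 2k$; * the moment matrix of order $r_k$ of $y$ and those of order $k$ of $y_0,\hat y_0$ are positive semidefinite, as are the localizing matrices of order $r_k-\lceil\deg g/2\rceil$ of $y$ for $g=g_{X,i},g_{U,i}$ and those of order $k-\lceil\deg g/2\rceil$ of $y_0,\hat y_0$ for $g=g_{X,i}$ (no condition when the order is negative). Let $d_k^*$ be the infimum of $\int_X w\,d\lambda$ over polynomials $v,w\in\mathbb R[x]$ of degree $\le 2k$ for which there are sums of squares of polynomials $q_i,t_i\in\mathbb R[x,u]$ and $p_i,s_i\in\mathbb R[x]$ with $$\mathcal A v=q_0+\sum_{i=1}^{n_X} q_i\,g_{X,i}+\sum_{i=1}^{n_U} t_i\,g_{U,i},\qquad w-v-1=p_0+\sum_{i=1}^{n_X} p_i\,g_{X,i},\qquad w=s_0+\sum_{i=1}^{n_X} s_i\,g_{X,i},$$ every term on the right being of degree $\le 2r_k$ in the first identity and $\le 2k$ in the other two. Then, both in discrete and in continuous time, all these values are finite, the suprema $p^*$ and $p_k^*$ are attained, and for all $k\ge 1$ $$d^*\le d_{k+1}^*\le d_k^*,\qquad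 \lim_{k\to\infty}d_k^*=d^*,\qquad p^*\le p_{k+1}^*\le p_k^*,\qquad \lim_{k\to\infty}p_k^*=p^*.$$ -/

import Mathlib

open MvPolynomial MeasureTheory Filter Topology

noncomputable section

namespace MCI

/-- The basic semialgebraic set `{z | gᵢ(z) ≥ 0 for all i}`. -/
def semialgSet {σ ι : Type*} (g : ι → MvPolynomial σ ℝ) : Set (σ → ℝ) :=
  {z | ∀ i, 0 ≤ eval z (g i)}

/-- One of the polynomials `gᵢ` is `R² - ‖z‖₂²` for some real constant `R`. -/
def HasBallConstraint {σ ι : Type*} [Fintype σ] (g : ι → MvPolynomial σ ℝ) : Prop :=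
  ∃ i, ∃ R : ℝ, g i = C (R ^ 2) - ∑ j, X j ^ 2

/-- The value `f(x,u) ∈ ℝⁿ` of a polynomial vector field in the variables `(x,u)`. -/
def evalField {n m : ℕ} (f : Fin n → MvPolynomial (Fin n ⊕ Fin m) ℝ)
    (x : Fin n → ℝ) (u : Fin m → ℝ) : Fin n → ℝ :=
  fun i => eval (Sum.elim x u) (f i)

/-! ### The infinite-dimensional linear programs

A nonnegative element of `M(K)` is a finite Borel measure with support in `K`.
The functions `v` are defined on all of `ℝⁿ`, since `v(f(x,u))` is needed where `f(x,u) ∉ X`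
and `grad v` is needed on all of `X`; the functions `w` are elements of `C(X)`. -/

/-- The measures `μ₀, μ̂₀` are supported in `K` and add up to the Lebesgue measure on `K`,
tested against `C(K)`. -/
def LebesgueSplit {n : ℕ} (K : Set (Fin n → ℝ)) (μ₀ μ₀' : Measure (Fin n → ℝ)) : Prop :=
  IsFiniteMeasure μ₀ ∧ IsFiniteMeasure μ₀' ∧ μ₀.support ⊆ K ∧ μ₀'.support ⊆ K ∧
  ∀ w : (Fin n → ℝ) → ℝ, ContinuousOn w K →
    ∫ x, w x ∂μ₀ + ∫ x, w x ∂μ₀' = ∫ x in K, w x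

/-- Objective values `μ₀(X)` of the feasible points of the discrete-time primal LP. -/
def discretePrimalValues {n m : ℕ} (f : Fin n → MvPolynomial (Fin n ⊕ Fin m) ℝ)
    (K : Set (Fin n → ℝ)) (U : Set (Fin m → ℝ)) (α : ℝ) : Set ℝ :=
  {c | ∃ (μ : Measure ((Fin n → ℝ) × (Fin m → ℝ))) (μ₀ μ₀' : Measure (Fin n → ℝ)),
    IsFiniteMeasure μ ∧ μ.support ⊆ K ×ˢ U ∧ LebesgueSplit K μ₀ μ₀' ∧
    (∀ v : (Fin n → ℝ) → ℝ, Continuous v →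
      ∫ z, v z.1 ∂μ = ∫ x, v x ∂μ₀ + α * ∫ z, v (evalField f z.1 z.2) ∂μ) ∧
    c = μ₀.real K}

/-- Objective values `μ₀(X)` of the feasible points of the continuous-time primal LP. -/
def continuousPrimalValues {n m : ℕ} (f : Fin n → MvPolynomial (Fin n ⊕ Fin m) ℝ)
    (K : Set (Fin n → ℝ)) (U : Set (Fin m → ℝ)) (β : ℝ) : Set ℝ :=
  {c | ∃ (μ : Measure ((Fin n → ℝ) × (Fin m → ℝ))) (μ₀ μ₀' : Measure (Fin n → ℝ)),
    IsFiniteMeasure μ ∧ μ.support ⊆ K ×ˢ U ∧ LebesgueSplit K μ₀ μ₀' ∧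
    (∀ v : (Fin n → ℝ) → ℝ, ContDiff ℝ 1 v →
      β * ∫ z, v z.1 ∂μ = ∫ x, v x ∂μ₀ + ∫ z, fderiv ℝ v z.1 (evalField f z.1 z.2) ∂μ) ∧
    c = μ₀.real K}

/-- Objective values `∫_X w dλ` of the feasible points of the discrete-time dual LP. -/
def discreteDualValues {n m : ℕ} (f : Fin n → MvPolynomial (Fin n ⊕ Fin m) ℝ)
    (K : Set (Fin n → ℝ)) (U : Set (Fin m → ℝ)) (α : ℝ) : Set ℝ :=
  {c | ∃ v w : (Fin n → ℝ) → ℝ, Continuous v ∧ ContinuousOn w K ∧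
    (∀ x ∈ K, ∀ u ∈ U, α * v (evalField f x u) ≤ v x) ∧
    (∀ x ∈ K, v x + 1 ≤ w x) ∧ (∀ x ∈ K, 0 ≤ w x) ∧
    c = ∫ x in K, w x}

/-- Objective values `∫_X w dλ` of the feasible points of the continuous-time dual LP. -/
def continuousDualValues {n m : ℕ} (f : Fin n → MvPolynomial (Fin n ⊕ Fin m) ℝ)
    (K : Set (Fin n → ℝ)) (U : Set (Fin m → ℝ)) (β : ℝ) : Set ℝ :=
  {c | ∃ v w : (Fin n → ℝ) → ℝ, ContDiff ℝ 1 v ∧ ContinuousOn w K ∧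
    (∀ x ∈ K, ∀ u ∈ U, fderiv ℝ v x (evalField f x u) ≤ β * v x) ∧
    (∀ x ∈ K, v x + 1 ≤ w x) ∧ (∀ x ∈ K, 0 ≤ w x) ∧
    c = ∫ x in K, w x}

/-! ### Moment and localizing matrices, truncated quadratic modules -/

/-- The linear functional `p ↦ ∑ₐ pₐ yₐ` of a sequence `y` indexed by the monomials. -/
def riesz {σ : Type*} (y : (σ →₀ ℕ) → ℝ) (p : MvPolynomial σ ℝ) : ℝ :=
  ∑ a ∈ p.support, p.coeff a * y a

/-- The localizing matrix of order `k` of `g`: rows and columns are indexed by the monomials of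
degree at most `k`. -/
def localizingMatrix {σ : Type*} (k : ℕ) (g : MvPolynomial σ ℝ) (y : (σ →₀ ℕ) → ℝ) :
    Matrix {a : σ →₀ ℕ // a.degree ≤ k} {a : σ →₀ ℕ // a.degree ≤ k} ℝ :=
  Matrix.of fun a b => riesz y (monomial (a.1 + b.1) 1 * g)

/-- The moment matrix of order `k`. -/
def momentMatrix {σ : Type*} (k : ℕ) (y : (σ →₀ ℕ) → ℝ) :
    Matrix {a : σ →₀ ℕ // a.degree ≤ k} {a : σ →₀ ℕ // a.degree ≤ k} ℝ :=
  Matrix.of fun a b => y (a.1 + b.1)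

/-- `⌈deg g / 2⌉`. -/
def halfDegree {σ : Type*} (g : MvPolynomial σ ℝ) : ℕ := (g.totalDegree + 1) / 2

/-- `y` is a sequence truncated to degree `2k` (extended by zero) which satisfies
`M_k(y) ⪰ 0` and `M_{k - dᵢ}(gᵢ, y) ⪰ 0`; there is no localizing constraint for `gᵢ` while
`k < dᵢ`. -/
def IsPseudoMoment {σ ι : Type*} (g : ι → MvPolynomial σ ℝ) (k : ℕ) (y : (σ →₀ ℕ) → ℝ) : Prop :=
  (∀ a : σ →₀ ℕ, 2 * k < a.degree → y a = 0) ∧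
  (momentMatrix k y).PosSemidef ∧
  ∀ i, halfDegree (g i) ≤ k → (localizingMatrix (k - halfDegree (g i)) (g i) y).PosSemidef

/-- `p = q₀ + ∑ᵢ qᵢ gᵢ` with sums of squares `q₀, qᵢ`, all terms being of degree at most `2k`. -/
def InQuadraticModule {σ ι : Type*} [Fintype ι] (g : ι → MvPolynomial σ ℝ) (k : ℕ)
    (p : MvPolynomial σ ℝ) : Prop :=
  ∃ (q₀ : MvPolynomial σ ℝ) (q : ι → MvPolynomial σ ℝ),
    IsSumSq q₀ ∧ q₀.totalDegree ≤ 2 * k ∧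
    (∀ i, IsSumSq (q i) ∧ (q i * g i).totalDegree ≤ 2 * k) ∧
    p = q₀ + ∑ i, q i * g i

/-- The polynomials in `(x,u)` that describe `X × U`. -/
def productConstraints {n m nX nU : ℕ} (gX : Fin nX → MvPolynomial (Fin n) ℝ)
    (gU : Fin nU → MvPolynomial (Fin m) ℝ) :
    Fin nX ⊕ Fin nU → MvPolynomial (Fin n ⊕ Fin m) ℝ :=
  Sum.elim (fun i => rename Sum.inl (gX i)) (fun i => rename Sum.inr (gU i))

/-- The moments of the Lebesgue measure on `K`. -/
def lebesgueMoment {n : ℕ} (K : Set (Fin n → ℝ)) (a : Fin n →₀ ℕ) : ℝ :=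
  ∫ x in K, ∏ i, x i ^ a i

/-! ### The finite-dimensional problems

Both are written for a map `A` that sends `v(x)` to the polynomial in `(x,u)` of the dynamics
constraint. -/

/-- `v(x) - α v(f(x,u))`. -/
def discreteOp {n m : ℕ} (f : Fin n → MvPolynomial (Fin n ⊕ Fin m) ℝ) (α : ℝ)
    (v : MvPolynomial (Fin n) ℝ) : MvPolynomial (Fin n ⊕ Fin m) ℝ :=
  rename Sum.inl v - C α * bind₁ f v

/-- `β v(x) - grad v · f(x,u)`. -/
def continuousOp {n m : ℕ} (f : Fin n → MvPolynomial (Fin n ⊕ Fin m) ℝ) (β : ℝ)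
    (v : MvPolynomial (Fin n) ℝ) : MvPolynomial (Fin n ⊕ Fin m) ℝ :=
  C β * rename Sum.inl v - ∑ i, rename Sum.inl (pderiv i v) * f i

/-- Objective values `(y₀)₀` of the feasible points of the primal moment relaxation of order `k`.
The sequences `y₀, ŷ₀` are truncated to degree `2k` and `y` to degree `2r`; the linear equality
constraints are those with `v, w` of degree at most `2k` which involve only moments of `y` of
degree at most `2r`. -/
def primalRelaxationValues {n m nX nU : ℕ}
    (A : MvPolynomial (Fin n) ℝ → MvPolynomial (Fin n ⊕ Fin m) ℝ)
    (gX : Fin nX → MvPolynomial (Fin n) ℝ) (gU : Fin nU → MvPolynomial (Fin m) ℝ)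
    (k r : ℕ) : Set ℝ :=
  {c | ∃ (y : (Fin n ⊕ Fin m →₀ ℕ) → ℝ) (y₀ y₀' : (Fin n →₀ ℕ) → ℝ),
    IsPseudoMoment (productConstraints gX gU) r y ∧
    IsPseudoMoment gX k y₀ ∧ IsPseudoMoment gX k y₀' ∧
    (∀ v : MvPolynomial (Fin n) ℝ, v.totalDegree ≤ 2 * k → (A v).totalDegree ≤ 2 * r →
      riesz y (A v) = riesz y₀ v) ∧
    (∀ w : MvPolynomial (Fin n) ℝ, w.totalDegree ≤ 2 * k →
      riesz y₀ w + riesz y₀' w = riesz (lebesgueMoment (semialgSet gX)) w) ∧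
    c = y₀ 0}

/-- Objective values `w'l` of the feasible points of the dual SOS approximation of order `k`:
`v, w` and the terms of the certificates on `X` are of degree at most `2k`, the terms of the
certificate on `X × U` of degree at most `2r`. -/
def dualApproximationValues {n m nX nU : ℕ}
    (A : MvPolynomial (Fin n) ℝ → MvPolynomial (Fin n ⊕ Fin m) ℝ)
    (gX : Fin nX → MvPolynomial (Fin n) ℝ) (gU : Fin nU → MvPolynomial (Fin m) ℝ)
    (k r : ℕ) : Set ℝ :=
  {c | ∃ v w : MvPolynomial (Fin n) ℝ, v.totalDegree ≤ 2 * k ∧ w.totalDegree ≤ 2 * k ∧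
    InQuadraticModule (productConstraints gX gU) r (A v) ∧
    InQuadraticModule gX k (w - v - 1) ∧
    InQuadraticModule gX k w ∧
    c = riesz (lebesgueMoment (semialgSet gX)) w}

/-- The infima of the sets `D k`, `k ≥ 1`, decrease to the infimum of `D∞`, and the maxima of the
sets `P k`, `k ≥ 1`, decrease to the maximum of `P∞`; all these infima exist in `ℝ` and all these
maxima are attained. -/
def ValuesConverge (Dinf : Set ℝ) (D : ℕ → Set ℝ) (Pinf : Set ℝ) (P : ℕ → Set ℝ) : Prop :=
  (∃ (dstar : ℝ) (d : ℕ → ℝ), IsGLB Dinf dstar ∧ (∀ k, 1 ≤ k → IsGLB (D k) (d k)) ∧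
    (∀ k, 1 ≤ k → dstar ≤ d (k + 1) ∧ d (k + 1) ≤ d k) ∧
    Tendsto d atTop (𝓝 dstar)) ∧
  (∃ (pstar : ℝ) (p : ℕ → ℝ), IsGreatest Pinf pstar ∧ (∀ k, 1 ≤ k → IsGreatest (P k) (p k)) ∧
    (∀ k, 1 ≤ k → pstar ≤ p (k + 1) ∧ p (k + 1) ≤ p k) ∧
    Tendsto p atTop (𝓝 pstar))

end MCI

end

/-!
The ball constraints make the quadratic modules of `X` and of `X × U` archimedean, and `A 1` is a
positive constant `δ` (`1 - α` or `β`). So constant `v, w` give a strictly feasible point of the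
sum-of-squares problem without degree bound, whose infimum `γ` is the limit of the `dₖ`. Conic
strong duality then yields linear functionals on polynomials, nonnegative on the quadratic modules,
that satisfy the constraints of the moment problem and attain the value `γ`.

Truncating these functionals gives feasible points of all relaxations. On the other hand, they are
integrals against measures by Putinar's theorem, and density of polynomials (in `C¹` on compact
sets, by convolution with polynomials that peak at the origin) extends the dynamics constraint to
all test functions. So `γ` is a value of the infinite-dimensional primal program as well, and weak
duality sandwiches all other values: `γ ≤ pₖ ≤ dₖ`, and `p ≤ γ ≤ d` at infinity. The maxima `pₖ`
are attained because the ball constraints bound all moments in terms of the mass.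
-/

noncomputable section

namespace MCI

/-! ### Positive functionals on a convex cone -/

section Cone

variable {D E : Type*} [AddCommGroup D] [Module ℝ D] [AddCommGroup E] [Module ℝ E]

/-- The M. Riesz extension theorem for a functional that is given along a linear map. -/
theorem exists_nonneg_extension (s : PointedCone ℝ E) (φ : D →ₗ[ℝ] E) (f : D →ₗ[ℝ] ℝ)
    (nonneg : ∀ d, φ d ∈ s → 0 ≤ f d) (dense : ∀ e, ∃ d, φ d + e ∈ s) :
    ∃ g : E →ₗ[ℝ] ℝ, (∀ e ∈ s, 0 ≤ g e) ∧ ∀ d, g (φ d) = f d := by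
  have ker_le : LinearMap.ker φ ≤ LinearMap.ker f := fun d hd => by
    rw [LinearMap.mem_ker] at hd ⊢
    refine le_antisymm ?_ (nonneg d (hd ▸ s.zero_mem))
    have := nonneg (-d) (by rw [map_neg, hd, neg_zero]; exact s.zero_mem)
    rwa [map_neg, Left.nonneg_neg_iff] at this
  let F : E →ₗ.[ℝ] ℝ :=
    ⟨LinearMap.range φ, (φ.ker.liftQ f ker_le).comp φ.quotKerEquivRange.symm.toLinearMap⟩
  have F_apply : ∀ d, F ⟨φ d, d, rfl⟩ = f d := fun d =>
    congrArg (φ.ker.liftQ f ker_le) (φ.quotKerEquivRange_symm_apply_image d ⟨d, rfl⟩)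
  obtain ⟨g, g_eq, g_nonneg⟩ := riesz_extension s F
    (by rintro ⟨_, d, rfl⟩ hd; exact (F_apply d).symm ▸ nonneg d hd)
    (fun e => (dense e).imp' (fun d => ⟨φ d, d, rfl⟩) fun _ hd => hd)
  exact ⟨g, g_nonneg, fun d => (g_eq ⟨φ d, d, rfl⟩).trans (F_apply d)⟩

/-- Strong duality for conic linear programs under Slater's condition. -/
theorem exists_dual_optimal (s : PointedCone ℝ E) (T : D →ₗ[ℝ] E) (b : E) (f : D →ₗ[ℝ] ℝ)
    (slater : ∀ e, ∃ d, T d + e ∈ s) {γ : ℝ} (hγ : IsGLB {c | ∃ d, T d - b ∈ s ∧ c = f d} γ) :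
    ∃ g : E →ₗ[ℝ] ℝ, (∀ e ∈ s, 0 ≤ g e) ∧ (∀ d, g (T d) = f d) ∧ g b = γ := by
  have nonneg : ∀ z : D × ℝ, T z.1 - z.2 • b ∈ s → 0 ≤ f z.1 - z.2 * γ := by
    rintro ⟨d, c⟩ hd
    have ht : 0 < |c| + 1 := by positivity
    have hct : 0 < c + (|c| + 1) := by linarith [neg_abs_le c]
    have feasible_add : ∀ d₁, T d₁ - b ∈ s →
        T ((c + (|c| + 1))⁻¹ • (d + (|c| + 1) • d₁)) - b ∈ s := fun d₁ hd₁ => by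
      convert s.smul_mem (inv_nonneg.2 hct.le) (add_mem hd (s.smul_mem ht.le hd₁)) using 1
      rw [eq_inv_smul_iff₀ hct.ne', smul_sub, map_smul, smul_inv_smul₀ hct.ne', map_add, map_smul]
      module
    have lower_bound : ((c + (|c| + 1)) * γ - f d) / (|c| + 1) ≤ γ := hγ.2 <| by
      rintro _ ⟨d₁, hd₁, rfl⟩
      have := hγ.1 ⟨_, feasible_add d₁ hd₁, rfl⟩
      rw [map_smul, map_add, map_smul, smul_eq_mul, smul_eq_mul, le_inv_mul_iff₀ hct] at this
      rw [div_le_iff₀ ht]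
      linarith
    rw [div_le_iff₀ ht] at lower_bound
    linarith
  obtain ⟨g, g_nonneg, hg⟩ := exists_nonneg_extension s
    (T.coprod (-LinearMap.toSpanSingleton ℝ E b)) (f.coprod (-LinearMap.toSpanSingleton ℝ ℝ γ))
    (fun z hz => by simpa [sub_eq_add_neg] using nonneg z (by simpa [sub_eq_add_neg] using hz))
    (fun e => (slater e).imp' (fun d => (d, 0)) fun d hd => by simpa using hd)
  refine ⟨g, g_nonneg, fun d => by simpa using hg (d, 0), ?_⟩
  simpa using hg (0, 1)

end Cone

theorem exists_mem_extremePoints_le {E : Type*} [AddCommGroup E] [Module ℝ E]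
    [TopologicalSpace E] [IsTopologicalAddGroup E] [ContinuousSMul ℝ E] [LocallyConvexSpace ℝ E]
    [T2Space E] {s : Set E} (hs : IsCompact s) (l : StrongDual ℝ E) {x : E} (hx : x ∈ s) :
    ∃ y ∈ s.extremePoints ℝ, l y ≤ l x := by
  have hexp : IsExposed ℝ s ((-l).toExposed s) := ContinuousLinearMap.toExposed.isExposed
  obtain ⟨z, hz, z_min⟩ := hs.exists_isMaxOn ⟨x, hx⟩ (-l).continuous.continuousOn
  obtain ⟨y, hy⟩ := (hexp.isCompact hs).extremePoints_nonempty ⟨z, hz, fun _ h => z_min h⟩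
  exact ⟨y, hexp.isExtreme.extremePoints_subset_extremePoints hy, neg_le_neg_iff.1 (hy.1.2 x hx)⟩

/-! ### Archimedean quadratic modules -/

section QuadraticModule

variable {A : Type*} [CommRing A] [Algebra ℝ A] {M : PointedCone ℝ A}

/-- `M` is a quadratic module of the real algebra `A`: it contains `1` and is stable under
multiplication by squares. -/
structure IsQuadraticModule (M : PointedCone ℝ A) : Prop where
  one_mem : (1 : A) ∈ M
  mul_self_mul_mem : ∀ a : A, ∀ m ∈ M, a * a * m ∈ M

theorem IsQuadraticModule.mul_self_mem (hM : IsQuadraticModule M) (a : A) : a * a ∈ M := by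
  simpa using hM.mul_self_mul_mem a 1 hM.one_mem

theorem IsQuadraticModule.algebraMap_mem (hM : IsQuadraticModule M) {c : ℝ} (hc : 0 ≤ c) :
    algebraMap ℝ A c ∈ M := by
  rw [Algebra.algebraMap_eq_smul_one]
  exact M.smul_mem hc hM.one_mem

theorem IsQuadraticModule.algebraMap_sub_mem_of_le (hM : IsQuadraticModule M) {a : A} {N N' : ℝ}
    (hN : algebraMap ℝ A N - a ∈ M) (hNN' : N ≤ N') : algebraMap ℝ A N' - a ∈ M := by
  simpa using add_mem (hM.algebraMap_mem (sub_nonneg.2 hNN')) hN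

/-- The elements of `A` that are bounded on both sides by a constant, for the preorder in which
the elements of `M` are nonnegative. -/
def boundedSubmodule (M : PointedCone ℝ A) : Submodule ℝ A where
  carrier := {a | ∃ N : ℝ, algebraMap ℝ A N - a ∈ M ∧ algebraMap ℝ A N + a ∈ M}
  zero_mem' := ⟨0, by simp⟩
  add_mem' := by
    rintro a b ⟨N, hN, hN'⟩ ⟨K, hK, hK'⟩
    refine ⟨N + K, ?_, ?_⟩ <;> rw [map_add]
    · rw [add_sub_add_comm]; exact add_mem hN hK
    · rw [add_add_add_comm]; exact add_mem hN' hK'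
  smul_mem' := by
    rintro c a ⟨N, hN, hN'⟩
    refine ⟨|c| * N, ?_⟩
    rw [map_mul, ← Algebra.smul_def]
    rcases le_total 0 c with hc | hc
    · rw [abs_of_nonneg hc, ← smul_sub, ← smul_add]
      exact ⟨M.smul_mem hc hN, M.smul_mem hc hN'⟩
    · rw [abs_of_nonpos hc]
      have := And.intro (M.smul_mem (neg_nonneg.2 hc) hN') (M.smul_mem (neg_nonneg.2 hc) hN)
      simpa [smul_add, smul_sub, sub_eq_add_neg] using this

theorem IsQuadraticModule.mem_boundedSubmodule_of_mul_self_le (hM : IsQuadraticModule M) {a : A}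
    {c : ℝ} (ha : algebraMap ℝ A c - a * a ∈ M) : a ∈ boundedSubmodule M := by
  have half_mul_half :
      algebraMap ℝ A (1 / 2) * algebraMap ℝ A (1 / 2) = algebraMap ℝ A (1 / 4) := by
    rw [← map_mul]; norm_num
  have half_add_half : algebraMap ℝ A (1 / 2) + algebraMap ℝ A (1 / 2) = 1 := by
    rw [← map_add]; norm_num
  refine ⟨c + 1 / 4, ?_, ?_⟩
  · convert add_mem ha (hM.mul_self_mem (a - algebraMap ℝ A (1 / 2))) using 1
    rw [map_add]
    linear_combination a * half_add_half - half_mul_half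
  · convert add_mem ha (hM.mul_self_mem (a + algebraMap ℝ A (1 / 2))) using 1
    rw [map_add]
    linear_combination -a * half_add_half - half_mul_half

theorem IsQuadraticModule.mul_self_mem_boundedSubmodule (hM : IsQuadraticModule M) {a : A}
    (ha : a ∈ boundedSubmodule M) : a * a ∈ boundedSubmodule M := by
  obtain ⟨N, hN, hN'⟩ := ha
  set K : ℝ := |N| + 1
  have hK : 0 < 2 * K := by positivity
  have hNK : N ≤ K := (le_abs_self N).trans (by simp [K])
  have h_sub := hM.algebraMap_sub_mem_of_le hN hNK
  have h_add : algebraMap ℝ A K + a ∈ M := by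
    simpa using hM.algebraMap_sub_mem_of_le (a := -a) (by simpa using hN') hNK
  refine ⟨K * K, ?_, add_mem (hM.algebraMap_mem (by positivity)) (hM.mul_self_mem a)⟩
  have key := M.smul_mem (inv_nonneg.2 hK.le) (add_mem
    (hM.mul_self_mul_mem (algebraMap ℝ A K - a) _ h_add)
    (hM.mul_self_mul_mem (algebraMap ℝ A K + a) _ h_sub))
  convert key using 1
  rw [eq_inv_smul_iff₀ hK.ne', Algebra.smul_def, map_mul, map_mul, map_ofNat]
  ring

theorem IsQuadraticModule.mul_mem_boundedSubmodule (hM : IsQuadraticModule M) {a b : A}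
    (ha : a ∈ boundedSubmodule M) (hb : b ∈ boundedSubmodule M) :
    a * b ∈ boundedSubmodule M := by
  have polarization : a * b = (1 / 4 : ℝ) • ((a + b) * (a + b) - (a - b) * (a - b)) := by
    rw [one_div, eq_inv_smul_iff₀ four_ne_zero, Algebra.smul_def, map_ofNat]
    ring
  rw [polarization]
  exact Submodule.smul_mem _ _ (sub_mem (hM.mul_self_mem_boundedSubmodule (add_mem ha hb))
    (hM.mul_self_mem_boundedSubmodule (sub_mem ha hb)))

/-- A quadratic module for which every element is bounded above by a constant. -/
structure IsArchimedean (M : PointedCone ℝ A) : Prop extends IsQuadraticModule M where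
  exists_bound : ∀ a : A, ∃ N : ℝ, algebraMap ℝ A N - a ∈ M

theorem IsQuadraticModule.isArchimedean_of_adjoin_eq_top (hM : IsQuadraticModule M) {s : Set A}
    (hs : Algebra.adjoin ℝ s = ⊤) (hsM : s ⊆ boundedSubmodule M) : IsArchimedean M where
  toIsQuadraticModule := hM
  exists_bound a := by
    have ha : a ∈ Algebra.adjoin ℝ s := hs ▸ Algebra.mem_top
    have one_mem : (1 : A) ∈ boundedSubmodule M :=
      ⟨1, by simp, by simpa using add_mem hM.one_mem hM.one_mem⟩
    have bounded : a ∈ boundedSubmodule M := by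
      induction ha using Algebra.adjoin_induction with
      | mem x hx => exact hsM hx
      | algebraMap c =>
        rw [Algebra.algebraMap_eq_smul_one]; exact Submodule.smul_mem _ _ one_mem
      | add x y _ _ hx hy => exact add_mem hx hy
      | mul x y _ _ hx hy => exact hM.mul_mem_boundedSubmodule hx hy
    exact bounded.imp fun _ h => h.1

theorem IsArchimedean.exists_nonneg_bound (hM : IsArchimedean M) (a : A) :
    ∃ N : ℝ, 0 ≤ N ∧ algebraMap ℝ A N - a ∈ M :=
  let ⟨N, hN⟩ := hM.exists_bound a
  ⟨max N 0, le_max_right N 0, hM.algebraMap_sub_mem_of_le hN (le_max_left N 0)⟩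

/-! ### States of an archimedean quadratic module -/

theorem map_algebraMap_eq_mul (L : A →ₗ[ℝ] ℝ) (c : ℝ) : L (algebraMap ℝ A c) = c * L 1 := by
  rw [Algebra.algebraMap_eq_smul_one, map_smul, smul_eq_mul]

theorem IsArchimedean.eq_zero_of_map_one_eq_zero (hM : IsArchimedean M) {L : A →ₗ[ℝ] ℝ}
    (hL : ∀ m ∈ M, 0 ≤ L m) (h1 : L 1 = 0) : L = 0 := by
  have nonpos : ∀ a, L a ≤ 0 := fun a => by
    obtain ⟨N, hN⟩ := hM.exists_bound a
    simpa [map_algebraMap_eq_mul, h1] using hL _ hN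
  ext a
  exact le_antisymm (nonpos a) (by simpa using nonpos (-a))

theorem map_mul_self_le_of_bounded_powers (L : A →ₗ[ℝ] ℝ) (hL : ∀ a, 0 ≤ L (a * a)) (g : A)
    (B : ℝ) (hB : ∀ k : ℕ, L (g ^ k * g ^ k) ≤ B) : L (g * g) ≤ L 1 := by
  by_contra! h
  set s : ℕ → ℝ := fun k => L (g ^ k * g ^ k) with hs
  have convex : ∀ k, s (k + 1) - s k ≤ s (k + 2) - s (k + 1) := fun k => by
    have h_sq := hL (g ^ k - g ^ (k + 2))
    have expand : (g ^ k - g ^ (k + 2)) * (g ^ k - g ^ (k + 2)) =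
        g ^ k * g ^ k - (2 : ℝ) • (g ^ (k + 1) * g ^ (k + 1)) + g ^ (k + 2) * g ^ (k + 2) := by
      rw [two_smul]; ring
    rw [expand, map_add, map_sub, map_smul, smul_eq_mul] at h_sq
    simp only [hs]
    linarith
  have slope_le : ∀ k, s 1 - s 0 ≤ s (k + 1) - s k := fun k =>
    Nat.rec le_rfl (fun k ih => ih.trans (convex k)) k
  have linear_growth : ∀ k : ℕ, s 0 + k * (s 1 - s 0) ≤ s k := fun k => by
    induction k with
    | zero => simp
    | succ k ih => push_cast; linarith [slope_le k]
  have slope_pos : 0 < s 1 - s 0 := by simpa [hs] using h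
  obtain ⟨k, hk⟩ := exists_nat_gt ((B - s 0) / (s 1 - s 0))
  rw [div_lt_iff₀ slope_pos] at hk
  linarith [linear_growth k, hB k]

theorem IsArchimedean.map_mul_self_mul_le (hM : IsArchimedean M) {L : A →ₗ[ℝ] ℝ}
    (hL : ∀ m ∈ M, 0 ≤ L m) {g : A} (hg : 1 - g * g ∈ M) {m : A} (hm : m ∈ M) :
    L (g * g * m) ≤ L m := by
  obtain ⟨N, hN_nonneg, hN⟩ := hM.exists_nonneg_bound m
  have powers_le : ∀ k : ℕ, L (g ^ k * g ^ k) ≤ L 1 := fun k => by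
    induction k with
    | zero => simp
    | succ k ih =>
      have h := hL _ (hM.mul_self_mul_mem (g ^ k) _ hg)
      rw [show g ^ k * g ^ k * (1 - g * g) = g ^ k * g ^ k - g ^ (k + 1) * g ^ (k + 1) by ring,
        map_sub] at h
      linarith
  have powers_mul_le : ∀ k : ℕ, L (g ^ k * g ^ k * m) ≤ N * L 1 := fun k => by
    have h := hL _ (hM.mul_self_mul_mem (g ^ k) _ hN)
    rw [mul_sub, map_sub, mul_comm _ (algebraMap ℝ A N), ← Algebra.smul_def, map_smul,
      smul_eq_mul] at h
    linarith [mul_le_mul_of_nonneg_left (powers_le k) hN_nonneg]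
  simpa using map_mul_self_le_of_bounded_powers (L.comp (LinearMap.mulRight ℝ m))
    (fun a => hL _ (hM.mul_self_mul_mem a m hm)) g (N * L 1) powers_mul_le

/-- The normalised functionals that are nonnegative on `M`. They are viewed as real functions on
`A`, so that the topology is the one of pointwise convergence. -/
def stateSet (M : PointedCone ℝ A) : Set (A → ℝ) :=
  {F | ∃ L : A →ₗ[ℝ] ℝ, (∀ m ∈ M, 0 ≤ L m) ∧ L 1 = 1 ∧ F = L}

theorem coe_mem_stateSet {L : A →ₗ[ℝ] ℝ} :
    (L : A → ℝ) ∈ stateSet M ↔ (∀ m ∈ M, 0 ≤ L m) ∧ L 1 = 1 := by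
  refine ⟨?_, fun h => ⟨L, h.1, h.2, rfl⟩⟩
  rintro ⟨L', h, h1, hLL'⟩
  obtain rfl : L = L' := DFunLike.coe_injective hLL'
  exact ⟨h, h1⟩

theorem isClosed_stateSet (M : PointedCone ℝ A) : IsClosed (stateSet M) := by
  have inter_eq : stateSet M = (⋂ (a : A) (b : A), {F : A → ℝ | F (a + b) = F a + F b}) ∩
      (⋂ (c : ℝ) (a : A), {F : A → ℝ | F (c • a) = c * F a}) ∩ {F | F 1 = 1} ∩
      (⋂ m ∈ M, {F : A → ℝ | 0 ≤ F m}) := by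
    ext F
    simp only [Set.mem_inter_iff, Set.mem_iInter, Set.mem_ofPred_eq]
    constructor
    · rintro ⟨L, hL, h1, rfl⟩
      exact ⟨⟨⟨map_add L, map_smul L⟩, h1⟩, hL⟩
    · rintro ⟨⟨⟨hadd, hsmul⟩, h1⟩, hpos⟩
      exact ⟨⟨⟨F, hadd⟩, hsmul⟩, hpos, h1, rfl⟩
  rw [inter_eq]
  refine .inter (.inter (.inter ?_ ?_) ?_) ?_
  · exact isClosed_iInter fun a => isClosed_iInter fun b => isClosed_eq (by fun_prop) (by fun_prop)
  · exact isClosed_iInter fun c => isClosed_iInter fun a => isClosed_eq (by fun_prop) (by fun_prop)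
  · exact isClosed_eq (by fun_prop) (by fun_prop)
  · exact isClosed_biInter fun m _ => isClosed_le (by fun_prop) (by fun_prop)

theorem IsArchimedean.isCompact_stateSet (hM : IsArchimedean M) : IsCompact (stateSet M) := by
  choose N hN using hM.exists_bound
  refine (isCompact_univ_pi fun a => isCompact_Icc).of_isClosed_subset (isClosed_stateSet M)
    (s := Set.univ.pi fun a => Set.Icc (-N (-a)) (N a)) ?_
  rintro _ ⟨L, hL, h1, rfl⟩ a -
  have upper := hL _ (hN a)
  have lower := hL _ (hN (-a))
  rw [map_sub, map_algebraMap_eq_mul, h1] at upper lower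
  rw [map_neg] at lower
  constructor <;> linarith

theorem IsArchimedean.eq_smul_of_mem_extremePoints (hM : IsArchimedean M) {L L₁ : A →ₗ[ℝ] ℝ}
    (hL : ⇑L ∈ (stateSet M).extremePoints ℝ) (hL₁ : ∀ m ∈ M, 0 ≤ L₁ m)
    (hle : ∀ m ∈ M, L₁ m ≤ L m) : L₁ = L₁ 1 • L := by
  obtain ⟨-, hL1⟩ := coe_mem_stateSet.1 hL.1
  have hL₂ : ∀ m ∈ M, 0 ≤ (L - L₁) m := fun m hm => sub_nonneg.2 (hle m hm)
  rcases (hL₁ 1 hM.one_mem).eq_or_lt with h0 | h_pos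
  · rw [← h0, zero_smul, hM.eq_zero_of_map_one_eq_zero hL₁ h0.symm]
  rcases (hL1 ▸ hle 1 hM.one_mem : L₁ 1 ≤ 1).eq_or_lt with h1 | h_lt
  · rw [h1, one_smul, ← sub_eq_zero.1 (hM.eq_zero_of_map_one_eq_zero hL₂ (by simp [hL1, h1]))]
  have h_pos' : 0 < (L - L₁) 1 := by simpa [hL1] using h_lt
  have normalize : ∀ {Λ : A →ₗ[ℝ] ℝ}, (∀ m ∈ M, 0 ≤ Λ m) → 0 < Λ 1 →
      ⇑((Λ 1)⁻¹ • Λ) ∈ stateSet M := fun hΛ hΛ1 =>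
    coe_mem_stateSet.2 ⟨fun m hm => mul_nonneg (inv_nonneg.2 hΛ1.le) (hΛ m hm),
      inv_mul_cancel₀ hΛ1.ne'⟩
  have mem_openSegment : ⇑L ∈ openSegment ℝ ⇑((L₁ 1)⁻¹ • L₁) ⇑(((L - L₁) 1)⁻¹ • (L - L₁)) := by
    refine ⟨L₁ 1, (L - L₁) 1, h_pos, h_pos', by simp [hL1], ?_⟩
    change ⇑(L₁ 1 • (L₁ 1)⁻¹ • L₁ + (L - L₁) 1 • ((L - L₁) 1)⁻¹ • (L - L₁)) = ⇑L
    rw [smul_inv_smul₀ h_pos.ne', smul_inv_smul₀ h_pos'.ne', add_sub_cancel]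
  have h_eq : (L₁ 1)⁻¹ • L₁ = L :=
    DFunLike.coe_injective (hL.2 (normalize hL₁ h_pos) (normalize hL₂ h_pos') mem_openSegment)
  conv_rhs => rw [← h_eq]
  rw [smul_inv_smul₀ h_pos.ne']

theorem IsArchimedean.map_mul_self_mul_of_mem_extremePoints (hM : IsArchimedean M)
    {L : A →ₗ[ℝ] ℝ} (hL : ⇑L ∈ (stateSet M).extremePoints ℝ) (g a : A) :
    L (g * g * a) = L (g * g) * L a := by
  obtain ⟨L_nonneg, -⟩ := coe_mem_stateSet.1 hL.1
  obtain ⟨N, hN_nonneg, hN⟩ := hM.exists_nonneg_bound (g * g)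
  have hN_pos : 0 < N + 1 := by linarith
  set e : A := (√(N + 1))⁻¹ • g
  have e_mul_self : e * e = (N + 1)⁻¹ • (g * g) := by
    rw [smul_mul_smul_comm, ← mul_inv, Real.mul_self_sqrt hN_pos.le]
  have e_bounded : 1 - e * e ∈ M := by
    convert M.smul_mem (inv_nonneg.2 hN_pos.le) (hM.algebraMap_sub_mem_of_le hN (by linarith :
      N ≤ N + 1)) using 1
    rw [smul_sub, ← e_mul_self, Algebra.algebraMap_eq_smul_one, inv_smul_smul₀ hN_pos.ne']
  have pure := hM.eq_smul_of_mem_extremePoints (L₁ := L.comp (LinearMap.mulLeft ℝ (e * e))) hL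
    (fun m hm => L_nonneg _ (hM.mul_self_mul_mem e m hm))
    (fun m hm => hM.map_mul_self_mul_le L_nonneg e_bounded hm)
  have h := LinearMap.congr_fun pure a
  simp only [LinearMap.comp_apply, LinearMap.mulLeft_apply, LinearMap.smul_apply, mul_one,
    e_mul_self, smul_mul_assoc, map_smul, smul_eq_mul, mul_assoc] at h
  exact mul_left_cancel₀ (inv_ne_zero hN_pos.ne') (by simpa only [mul_assoc] using h)

theorem IsArchimedean.map_mul_of_mem_extremePoints (hM : IsArchimedean M) {L : A →ₗ[ℝ] ℝ}
    (hL : ⇑L ∈ (stateSet M).extremePoints ℝ) (a b : A) : L (a * b) = L a * L b := by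
  have polarization : a = (1 / 4 : ℝ) • ((a + 1) * (a + 1) - (a - 1) * (a - 1)) := by
    rw [one_div, eq_inv_smul_iff₀ four_ne_zero, Algebra.smul_def, map_ofNat]
    ring
  rw [polarization, smul_mul_assoc, sub_mul, map_smul, map_smul, map_sub, map_sub,
    hM.map_mul_self_mul_of_mem_extremePoints hL, hM.map_mul_self_mul_of_mem_extremePoints hL,
    smul_eq_mul, smul_eq_mul, ← sub_mul, mul_assoc]

theorem IsArchimedean.exists_algHom_le (hM : IsArchimedean M) {L : A →ₗ[ℝ] ℝ}
    (hL : ∀ m ∈ M, 0 ≤ L m) (h1 : L 1 = 1) (p : A) :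
    ∃ φ : A →ₐ[ℝ] ℝ, (∀ m ∈ M, 0 ≤ φ m) ∧ φ p ≤ L p := by
  obtain ⟨F, hF, hFp⟩ := exists_mem_extremePoints_le hM.isCompact_stateSet
    (ContinuousLinearMap.proj p) (coe_mem_stateSet.2 ⟨hL, h1⟩)
  obtain ⟨φ, φ_nonneg, φ_one, rfl⟩ := hF.1
  exact ⟨AlgHom.ofLinearMap φ φ_one (hM.map_mul_of_mem_extremePoints hF), φ_nonneg, hFp⟩

theorem IsArchimedean.map_nonneg (hM : IsArchimedean M) {L : A →ₗ[ℝ] ℝ} (hL : ∀ m ∈ M, 0 ≤ L m)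
    {p : A} (hp : ∀ φ : A →ₐ[ℝ] ℝ, (∀ m ∈ M, 0 ≤ φ m) → 0 ≤ φ p) : 0 ≤ L p := by
  rcases (hL 1 hM.one_mem).eq_or_lt with h0 | h_pos
  · rw [hM.eq_zero_of_map_one_eq_zero hL h0.symm, LinearMap.zero_apply]
  obtain ⟨φ, φ_nonneg, hφ⟩ := hM.exists_algHom_le (L := (L 1)⁻¹ • L)
    (fun m hm => mul_nonneg (inv_nonneg.2 h_pos.le) (hL m hm)) (inv_mul_cancel₀ h_pos.ne') p
  exact nonneg_of_mul_nonneg_right ((hp φ φ_nonneg).trans hφ) (inv_pos.2 h_pos)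

end QuadraticModule

section GeneratedQuadraticModule

variable {A ι : Type*} [CommRing A] [Algebra ℝ A] [Fintype ι] {g : ι → A}

theorem isSumSq_algebraMap {c : ℝ} (hc : 0 ≤ c) : IsSumSq (algebraMap ℝ A c) := by
  rw [← Real.mul_self_sqrt hc, map_mul]
  exact IsSumSq.mul_self _

/-- The quadratic module generated by the elements `gᵢ`. -/
def quadraticModule (g : ι → A) : PointedCone ℝ A where
  carrier := {p | ∃ (q₀ : A) (q : ι → A),
    IsSumSq q₀ ∧ (∀ i, IsSumSq (q i)) ∧ p = q₀ + ∑ i, q i * g i}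
  zero_mem' := ⟨0, 0, .zero, fun _ => .zero, by simp⟩
  add_mem' := by
    rintro _ _ ⟨q₀, q, h₀, h, rfl⟩ ⟨q₀', q', h₀', h', rfl⟩
    refine ⟨q₀ + q₀', q + q', h₀.add h₀', fun i => (h i).add (h' i), ?_⟩
    simp only [Pi.add_apply, add_mul, Finset.sum_add_distrib, add_add_add_comm]
  smul_mem' := by
    rintro ⟨c, hc⟩ _ ⟨q₀, q, h₀, h, rfl⟩
    refine ⟨algebraMap ℝ A c * q₀, fun i => algebraMap ℝ A c * q i,
      (isSumSq_algebraMap hc).mul h₀, fun i => (isSumSq_algebraMap hc).mul (h i), ?_⟩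
    rw [Nonneg.mk_smul, Algebra.smul_def, mul_add, Finset.mul_sum]
    simp only [mul_assoc]

theorem mul_mem_quadraticModule {q : A} (hq : IsSumSq q) (i : ι) :
    q * g i ∈ quadraticModule g := by
  classical
  exact ⟨0, Pi.single i q, .zero, fun j => by
    rcases eq_or_ne j i with rfl | h <;> simp [*, IsSumSq.zero], by simp [Pi.single_apply]⟩

theorem mem_quadraticModule_self (i : ι) : g i ∈ quadraticModule g := by
  simpa using mul_mem_quadraticModule (g := g) IsSumSq.one i

theorem isQuadraticModule_quadraticModule (g : ι → A) :
    IsQuadraticModule (quadraticModule g) where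
  one_mem := ⟨1, 0, .one, fun _ => .zero, by simp⟩
  mul_self_mul_mem := by
    rintro a _ ⟨q₀, q, h₀, h, rfl⟩
    refine ⟨a * a * q₀, fun i => a * a * q i, (IsSumSq.mul_self a).mul h₀,
      fun i => (IsSumSq.mul_self a).mul (h i), ?_⟩
    rw [mul_add, Finset.mul_sum]
    simp only [mul_assoc]

end GeneratedQuadraticModule

section Polynomial

variable {σ ι : Type*} {g : ι → MvPolynomial σ ℝ}

theorem eval_nonneg_of_isSumSq {q : MvPolynomial σ ℝ} (hq : IsSumSq q) (z : σ → ℝ) :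
    0 ≤ eval z q := by
  induction hq with
  | zero => simp
  | sq_add a _ ih =>
    rw [map_add, map_mul]
    exact add_nonneg (mul_self_nonneg _) ih

theorem isClosed_semialgSet (g : ι → MvPolynomial σ ℝ) : IsClosed (semialgSet g) := by
  rw [semialgSet, Set.ofPred_forall]
  exact isClosed_iInter fun i => isClosed_le continuous_const (continuous_eval _)

variable [Fintype ι]

theorem eval_nonneg_of_mem_quadraticModule {p : MvPolynomial σ ℝ} (hp : p ∈ quadraticModule g)
    {z : σ → ℝ} (hz : z ∈ semialgSet g) : 0 ≤ eval z p := by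
  obtain ⟨q₀, q, h₀, h, rfl⟩ := hp
  rw [map_add, map_sum]
  refine add_nonneg (eval_nonneg_of_isSumSq h₀ z) (Finset.sum_nonneg fun i _ => ?_)
  rw [map_mul]
  exact mul_nonneg (eval_nonneg_of_isSumSq (h i) z) (hz i)

theorem InQuadraticModule.mem_quadraticModule {k : ℕ} {p : MvPolynomial σ ℝ}
    (hp : InQuadraticModule g k p) : p ∈ quadraticModule g :=
  let ⟨q₀, q, h₀, _, h, hpq⟩ := hp
  ⟨q₀, q, h₀, fun i => (h i).1, hpq⟩

theorem InQuadraticModule.mono {k l : ℕ} (hkl : k ≤ l) {p : MvPolynomial σ ℝ}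
    (hp : InQuadraticModule g k p) : InQuadraticModule g l p :=
  let ⟨q₀, q, h₀, hd, h, hpq⟩ := hp
  ⟨q₀, q, h₀, by lia, fun i => ⟨(h i).1, (h i).2.trans (by lia)⟩, hpq⟩

theorem InQuadraticModule.totalDegree_le {k : ℕ} {p : MvPolynomial σ ℝ}
    (hp : InQuadraticModule g k p) : p.totalDegree ≤ 2 * k := by
  obtain ⟨q₀, q, -, hd, h, rfl⟩ := hp
  exact (totalDegree_add _ _).trans (max_le hd (totalDegree_finsetSum_le fun i _ => (h i).2))

theorem exists_inQuadraticModule {p : MvPolynomial σ ℝ} (hp : p ∈ quadraticModule g) :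
    ∃ k, InQuadraticModule g k p := by
  obtain ⟨q₀, q, h₀, h, rfl⟩ := hp
  refine ⟨q₀.totalDegree + ∑ i, (q i * g i).totalDegree, q₀, q, h₀, by lia,
    fun i => ⟨h i, ?_⟩, rfl⟩
  have := Finset.single_le_sum (f := fun i => (q i * g i).totalDegree)
    (fun _ _ => Nat.zero_le _) (Finset.mem_univ i)
  lia

/-- Every coordinate is bounded with respect to the quadratic module generated by `g`: this is
the archimedean condition of Putinar's theorem. -/
def BoundsCoordinates (g : ι → MvPolynomial σ ℝ) : Prop :=
  ∀ j, ∃ c : ℝ, C c - X j * X j ∈ quadraticModule g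

theorem BoundsCoordinates.isArchimedean (hg : BoundsCoordinates g) :
    IsArchimedean (quadraticModule g) :=
  (isQuadraticModule_quadraticModule g).isArchimedean_of_adjoin_eq_top adjoin_range_X <| by
    rintro _ ⟨j, rfl⟩
    obtain ⟨c, hc⟩ := hg j
    exact (isQuadraticModule_quadraticModule g).mem_boundedSubmodule_of_mul_self_le hc

theorem BoundsCoordinates.isCompact (hg : BoundsCoordinates g) : IsCompact (semialgSet g) := by
  choose c hc using hg
  refine (isCompact_univ_pi fun j => isCompact_Icc (a := -√(c j)) (b := √(c j))).of_isClosed_subset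
    (isClosed_semialgSet g) fun z hz j _ => abs_le.1 (Real.abs_le_sqrt ?_)
  have h := eval_nonneg_of_mem_quadraticModule (hc j) hz
  rwa [map_sub, map_mul, eval_C, eval_X, sub_nonneg, ← sq] at h

theorem BoundsCoordinates.map_nonneg (hg : BoundsCoordinates g) {L : MvPolynomial σ ℝ →ₗ[ℝ] ℝ}
    (hL : ∀ m ∈ quadraticModule g, 0 ≤ L m) {p : MvPolynomial σ ℝ}
    (hp : ∀ z ∈ semialgSet g, 0 ≤ eval z p) : 0 ≤ L p := by
  refine hg.isArchimedean.map_nonneg hL fun φ φ_nonneg => ?_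
  have φ_eq_eval : ∀ q, φ q = eval (φ ∘ X) q := fun q => by
    rw [← coe_aeval_eq_eval]; exact DFunLike.congr_fun (aeval_unique φ) q
  rw [φ_eq_eval]
  exact hp _ fun i => φ_eq_eval (g i) ▸ φ_nonneg _ (mem_quadraticModule_self i)

end Polynomial

/-! ### Polynomials and measures on a compact set -/

section Compact

open CompactlySupported in
theorem exists_measure_of_nonneg {K : Type*} [TopologicalSpace K] [CompactSpace K] [T2Space K]
    [MeasurableSpace K] [BorelSpace K] (L : C(K, ℝ) →ₗ[ℝ] ℝ) (hL : ∀ w, 0 ≤ w → 0 ≤ L w) :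
    ∃ μ : Measure K, IsFiniteMeasure μ ∧ ∀ w, L w = ∫ x, w x ∂μ := by
  let Λ : C_c(K, ℝ) →ₚ[ℝ] ℝ := PositiveLinearMap.mk₀
    { toFun := fun w => L w
      map_add' := fun w w' => L.map_add w w'
      map_smul' := fun c w => L.map_smul c w } fun w hw => hL w hw
  exact ⟨RealRMK.rieszMeasure Λ, inferInstance, fun w =>
    (RealRMK.integral_rieszMeasure Λ (CompactlySupportedContinuousMap.continuousMapEquiv w)).symm⟩

variable {σ : Type*} {K : Set (σ → ℝ)}

/-- The restriction of polynomials to `K`. -/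
def polynomialRestriction (K : Set (σ → ℝ)) : MvPolynomial σ ℝ →ₐ[ℝ] C(K, ℝ) :=
  aeval fun j => ⟨fun z => z.1 j, (continuous_apply j).comp continuous_subtype_val⟩

theorem polynomialRestriction_apply (p : MvPolynomial σ ℝ) (z : K) :
    polynomialRestriction K p z = eval z.1 p := by
  induction p using MvPolynomial.induction_on with
  | C a => simp [polynomialRestriction]
  | add p q hp hq => simp [hp, hq]
  | mul_X p j hp => rw [map_mul, ContinuousMap.mul_apply, hp]; simp [polynomialRestriction]

theorem exists_polynomial_near (hK : IsCompact K) {w : (σ → ℝ) → ℝ} (hw : ContinuousOn w K)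
    {ε : ℝ} (hε : 0 < ε) : ∃ p : MvPolynomial σ ℝ, ∀ x ∈ K, |eval x p - w x| < ε := by
  have : CompactSpace K := isCompact_iff_compactSpace.1 hK
  have separates : (polynomialRestriction K).range.SeparatesPoints := fun x y hxy => by
    obtain ⟨j, hj⟩ := Function.ne_iff.1 fun h => hxy (Subtype.ext h)
    exact ⟨_, ⟨polynomialRestriction K (X j), ⟨X j, rfl⟩, rfl⟩,
      by simpa [polynomialRestriction_apply] using hj⟩
  obtain ⟨⟨_, p, rfl⟩, hp⟩ := ContinuousMap.exists_mem_subalgebra_near_continuous_of_separatesPoints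
    _ separates (K.domRestrict w) hw.domRestrict ε hε
  exact ⟨p, fun x hx => by rw [← polynomialRestriction_apply p ⟨x, hx⟩]; exact hp ⟨x, hx⟩⟩

/-- **Putinar's theorem** on the moment problem. -/
theorem BoundsCoordinates.exists_measure {ι : Type*} [Fintype ι] [Finite σ]
    {g : ι → MvPolynomial σ ℝ} (hg : BoundsCoordinates g) {L : MvPolynomial σ ℝ →ₗ[ℝ] ℝ}
    (hL : ∀ m ∈ quadraticModule g, 0 ≤ L m) :
    ∃ μ : Measure (σ → ℝ), IsFiniteMeasure μ ∧ (∀ᵐ z ∂μ, z ∈ semialgSet g) ∧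
      ∀ p, L p = ∫ z, eval z p ∂μ := by
  set K := semialgSet g
  have : CompactSpace K := isCompact_iff_compactSpace.1 hg.isCompact
  obtain ⟨Λ, Λ_nonneg, hΛ⟩ := exists_nonneg_extension (.positive ℝ C(K, ℝ))
    (polynomialRestriction K).toLinearMap L
    (fun p hp => hg.map_nonneg hL fun z hz =>
      (hp ⟨z, hz⟩).trans_eq (polynomialRestriction_apply p ⟨z, hz⟩))
    (fun w => ⟨C ‖w‖, fun z => by
      simpa [polynomialRestriction_apply] using
        neg_le_iff_add_nonneg'.1 (neg_le_of_abs_le (w.norm_coe_le_norm z))⟩)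
  obtain ⟨μ, hμ_finite, hμ⟩ := exists_measure_of_nonneg Λ Λ_nonneg
  refine ⟨μ.map Subtype.val, inferInstance, ?_, fun p => ?_⟩
  · exact (ae_map_iff measurable_subtype_coe.aemeasurable
      (isClosed_semialgSet g).measurableSet).2 (.of_forall Subtype.property)
  · rw [integral_map measurable_subtype_coe.aemeasurable (continuous_eval p).aestronglyMeasurable,
      ← hΛ, hμ]
    simp [polynomialRestriction_apply]

theorem integrable_of_continuousOn_compact {Z : Type*} [TopologicalSpace Z] [MeasurableSpace Z]
    [OpensMeasurableSpace Z] [T2Space Z] {μ : Measure Z} [IsFiniteMeasureOnCompacts μ] {S : Set Z}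
    (hS : IsCompact S) (hμ : ∀ᵐ z ∂μ, z ∈ S) {E : Type*} [NormedAddCommGroup E] {w : Z → E}
    (hw : ContinuousOn w S) : Integrable w μ := by
  rw [← Measure.restrict_eq_self_of_ae_mem hμ]
  exact hw.integrableOn_compact' hS hS.measurableSet

theorem tendsto_integral_of_tendstoUniformlyOn {Z : Type*} [TopologicalSpace Z] [MeasurableSpace Z]
    [OpensMeasurableSpace Z] [T2Space Z] {μ : Measure Z} [IsFiniteMeasure μ] {S : Set Z}
    (hS : IsCompact S) (hμ : ∀ᵐ z ∂μ, z ∈ S) {F : ℕ → Z → ℝ} {w : Z → ℝ}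
    (hF : ∀ k, ContinuousOn (F k) S) (hw : ContinuousOn w S)
    (hFw : TendstoUniformlyOn F w atTop S) :
    Tendsto (fun k => ∫ z, F k z ∂μ) atTop (𝓝 (∫ z, w z ∂μ)) := by
  refine tendsto_integral_filter_of_dominated_convergence (fun z => |w z| + 1) ?_ ?_ ?_ ?_
  · exact .of_forall fun k => (integrable_of_continuousOn_compact hS hμ (hF k)).aestronglyMeasurable
  · filter_upwards [Metric.tendstoUniformlyOn_iff.1 hFw 1 one_pos] with k hk
    filter_upwards [hμ] with z hz
    have := norm_sub_norm_le (F k z) (w z)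
    rw [← dist_eq_norm, dist_comm] at this
    exact sub_le_iff_le_add'.1 (this.trans (hk z hz).le)
  · exact (integrable_of_continuousOn_compact hS hμ hw).abs.add (integrable_const 1)
  · exact hμ.mono fun z hz => hFw.tendsto_at hz

theorem exists_polynomial_tendstoUniformlyOn (hK : IsCompact K) {w : (σ → ℝ) → ℝ}
    (hw : ContinuousOn w K) :
    ∃ p : ℕ → MvPolynomial σ ℝ, TendstoUniformlyOn (fun k x => eval x (p k)) w atTop K := by
  choose p hp using fun k : ℕ => exists_polynomial_near hK hw (Nat.one_div_pos_of_nat (n := k))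
  refine ⟨p, Metric.tendstoUniformlyOn_iff.2 fun ε hε => ?_⟩
  filter_upwards [tendsto_one_div_add_atTop_nhds_zero_nat.eventually (gt_mem_nhds hε)]
    with k hk x hx
  rw [dist_comm]
  exact (hp k x hx).trans hk

end Compact

/-! ### Riesz functionals -/

section Riesz

variable {σ : Type*}

/-- `riesz y` as a linear map. -/
def rieszLinear (y : (σ →₀ ℕ) → ℝ) : MvPolynomial σ ℝ →ₗ[ℝ] ℝ :=
  (basisMonomials σ ℝ).constr ℝ y

theorem rieszLinear_monomial (y : (σ →₀ ℕ) → ℝ) (a : σ →₀ ℕ) (c : ℝ) :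
    rieszLinear y (monomial a c) = c * y a := by
  have h : monomial a c = c • basisMonomials σ ℝ a := by
    rw [coe_basisMonomials, smul_monomial, smul_eq_mul, mul_one]
  rw [h, map_smul, rieszLinear, Module.Basis.constr_basis, smul_eq_mul]

theorem rieszLinear_one (y : (σ →₀ ℕ) → ℝ) : rieszLinear y 1 = y 0 := by
  rw [← C_1, ← monomial_zero', rieszLinear_monomial, one_mul]

theorem rieszLinear_apply (y : (σ →₀ ℕ) → ℝ) (p : MvPolynomial σ ℝ) :
    rieszLinear y p = riesz y p := by
  conv_lhs => rw [← support_sum_monomial_coeff p]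
  rw [map_sum]
  exact Finset.sum_congr rfl fun a _ => rieszLinear_monomial y a _

theorem rieszLinear_map_monomial (L : MvPolynomial σ ℝ →ₗ[ℝ] ℝ) :
    rieszLinear (fun a => L (monomial a 1)) = L :=
  (basisMonomials σ ℝ).ext fun a => by
    rw [coe_basisMonomials, rieszLinear_monomial, one_mul]

theorem rieszLinear_lebesgueMoment {n : ℕ} {K : Set (Fin n → ℝ)} (hK : IsCompact K)
    (p : MvPolynomial (Fin n) ℝ) : rieszLinear (lebesgueMoment K) p = ∫ x in K, eval x p := by
  simp only [rieszLinear_apply, riesz, lebesgueMoment, eval_eq']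
  rw [integral_finsetSum]
  · simp only [integral_const_mul]
  · intro a _
    exact (Continuous.continuousOn (by fun_prop)).integrableOn_compact hK

theorem continuous_rieszLinear (p : MvPolynomial σ ℝ) :
    Continuous fun y : (σ →₀ ℕ) → ℝ => rieszLinear y p := by
  simp only [rieszLinear_apply, riesz]
  fun_prop

theorem rieszLinear_congr {y y' : (σ →₀ ℕ) → ℝ} {k : ℕ} (h : ∀ a, a.degree ≤ k → y a = y' a)
    {p : MvPolynomial σ ℝ} (hp : p.totalDegree ≤ k) : rieszLinear y p = rieszLinear y' p := by
  simp only [rieszLinear_apply, riesz]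
  exact Finset.sum_congr rfl fun a ha => by rw [h a ((le_totalDegree ha).trans hp)]

/-- The sequence of moments of degree at most `k` of a linear functional, extended by zero. -/
def truncatedMoments (k : ℕ) (L : MvPolynomial σ ℝ →ₗ[ℝ] ℝ) (a : σ →₀ ℕ) : ℝ :=
  if a.degree ≤ k then L (monomial a 1) else 0

theorem rieszLinear_truncatedMoments {k : ℕ} (L : MvPolynomial σ ℝ →ₗ[ℝ] ℝ)
    {p : MvPolynomial σ ℝ} (hp : p.totalDegree ≤ k) :
    rieszLinear (truncatedMoments k L) p = L p :=
  (rieszLinear_congr (fun _ ha => if_pos ha) hp).trans <| by rw [rieszLinear_map_monomial]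

end Riesz

/-! ### Pseudo-moments -/

section PseudoMoment

variable {σ ι : Type*} {g : ι → MvPolynomial σ ℝ} {k : ℕ} {y : (σ →₀ ℕ) → ℝ}

/-- The polynomial of degree at most `k` with coefficient vector `x`. -/
def polynomialOfCoeffs (k : ℕ) :
    ({a : σ →₀ ℕ // a.degree ≤ k} →₀ ℝ) →ₗ[ℝ] MvPolynomial σ ℝ :=
  Finsupp.linearCombination ℝ fun a => monomial a.1 1

theorem totalDegree_polynomialOfCoeffs_le (x : {a : σ →₀ ℕ // a.degree ≤ k} →₀ ℝ) :
    (polynomialOfCoeffs k x).totalDegree ≤ k := by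
  rw [polynomialOfCoeffs, Finsupp.linearCombination_apply]
  refine totalDegree_finsetSum_le fun a _ => ?_
  dsimp only
  rw [smul_monomial]
  exact (totalDegree_monomial_le _ _).trans a.2

theorem exists_polynomialOfCoeffs_eq {h : MvPolynomial σ ℝ} (hh : h.totalDegree ≤ k) :
    ∃ x, polynomialOfCoeffs k x = h := by
  refine ⟨∑ a ∈ h.support.attach,
    .single ⟨a.1, (le_totalDegree a.2).trans hh⟩ (coeff a.1 h), ?_⟩
  simp only [polynomialOfCoeffs, map_sum, Finsupp.linearCombination_single, smul_monomial,
    smul_eq_mul, mul_one]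
  rw [Finset.sum_attach h.support fun a => monomial a (coeff a h), support_sum_monomial_coeff]

theorem localizingMatrix_quadraticForm (p : MvPolynomial σ ℝ) (y : (σ →₀ ℕ) → ℝ)
    (x : {a : σ →₀ ℕ // a.degree ≤ k} →₀ ℝ) :
    (x.sum fun a xa => x.sum fun b xb => star xa * localizingMatrix k p y a b * xb) =
      rieszLinear y (polynomialOfCoeffs k x * polynomialOfCoeffs k x * p) := by
  simp only [polynomialOfCoeffs, Finsupp.linearCombination_apply, Finsupp.sum, Finset.sum_mul,
    Finset.mul_sum, map_sum]
  refine Finset.sum_congr rfl fun a _ => Finset.sum_congr rfl fun b _ => ?_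
  have term_eq : x b • monomial b.1 (1 : ℝ) * x a • monomial a.1 1 * p =
      (x a * x b) • (monomial (a.1 + b.1) 1 * p) := by
    rw [mul_comm (x b • _), smul_mul_smul_comm, monomial_mul, one_mul, smul_mul_assoc]
  rw [term_eq, map_smul, rieszLinear_apply]
  simp only [localizingMatrix, Matrix.of_apply, star_trivial, smul_eq_mul]
  ring

theorem localizingMatrix_posSemidef_iff {p : MvPolynomial σ ℝ} :
    (localizingMatrix k p y).PosSemidef ↔
      ∀ h : MvPolynomial σ ℝ, h.totalDegree ≤ k → 0 ≤ rieszLinear y (h * h * p) := by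
  have isHermitian : (localizingMatrix k p y).IsHermitian := by
    ext a b
    simp [localizingMatrix, add_comm]
  simp only [Matrix.PosSemidef, isHermitian, true_and, localizingMatrix_quadraticForm]
  refine ⟨fun H h hh => ?_, fun H x => H _ (totalDegree_polynomialOfCoeffs_le x)⟩
  obtain ⟨x, rfl⟩ := exists_polynomialOfCoeffs_eq hh
  exact H x

theorem momentMatrix_eq_localizingMatrix (k : ℕ) (y : (σ →₀ ℕ) → ℝ) :
    momentMatrix k y = localizingMatrix k 1 y := by
  ext a b
  simp [momentMatrix, localizingMatrix, ← rieszLinear_apply, rieszLinear_monomial]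

theorem isPseudoMoment_iff :
    IsPseudoMoment g k y ↔ (∀ a : σ →₀ ℕ, 2 * k < a.degree → y a = 0) ∧
      (∀ h : MvPolynomial σ ℝ, h.totalDegree ≤ k → 0 ≤ rieszLinear y (h * h)) ∧
      ∀ i, halfDegree (g i) ≤ k → ∀ h : MvPolynomial σ ℝ, h.totalDegree ≤ k - halfDegree (g i) →
        0 ≤ rieszLinear y (h * h * g i) := by
  simp only [IsPseudoMoment, momentMatrix_eq_localizingMatrix, localizingMatrix_posSemidef_iff,
    mul_one]

theorem isClosed_isPseudoMoment (g : ι → MvPolynomial σ ℝ) (k : ℕ) :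
    IsClosed {y | IsPseudoMoment g k y} := by
  simp only [isPseudoMoment_iff, Set.ofPred_and, Set.ofPred_forall]
  refine IsClosed.inter ?_ (IsClosed.inter ?_ ?_)
  · exact isClosed_iInter fun a => isClosed_iInter fun _ =>
      isClosed_eq (continuous_apply a) continuous_const
  · exact isClosed_iInter fun h => isClosed_iInter fun _ =>
      isClosed_le continuous_const (continuous_rieszLinear _)
  · exact isClosed_iInter fun i => isClosed_iInter fun _ => isClosed_iInter fun h =>
      isClosed_iInter fun _ => isClosed_le continuous_const (continuous_rieszLinear _)

theorem totalDegree_mul_self_le {h : MvPolynomial σ ℝ} (hh : h.totalDegree ≤ k) :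
    (h * h).totalDegree ≤ 2 * k :=
  (totalDegree_mul _ _).trans (by lia)

theorem totalDegree_mul_self_mul_le {h p : MvPolynomial σ ℝ} (hp : halfDegree p ≤ k)
    (hh : h.totalDegree ≤ k - halfDegree p) : (h * h * p).totalDegree ≤ 2 * k := by
  refine (totalDegree_mul _ _).trans ?_
  have := totalDegree_mul_self_le hh
  rw [halfDegree] at *
  lia

theorem IsPseudoMoment.truncate {l : ℕ} (hlk : l ≤ k) (hy : IsPseudoMoment g k y) :
    IsPseudoMoment g l (truncatedMoments (2 * l) (rieszLinear y)) := by
  obtain ⟨-, moment_nonneg, localizing_nonneg⟩ := isPseudoMoment_iff.1 hy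
  refine isPseudoMoment_iff.2 ⟨fun a ha => if_neg (by lia), fun h hh => ?_, fun i hi h hh => ?_⟩
  · rw [rieszLinear_truncatedMoments _ (totalDegree_mul_self_le hh)]
    exact moment_nonneg h (hh.trans hlk)
  · rw [rieszLinear_truncatedMoments _ (totalDegree_mul_self_mul_le hi hh)]
    exact localizing_nonneg i (hi.trans hlk) h (hh.trans (by lia))

theorem isPseudoMoment_truncatedMoments [Fintype ι] {L : MvPolynomial σ ℝ →ₗ[ℝ] ℝ}
    (hL : ∀ p ∈ quadraticModule g, 0 ≤ L p) (k : ℕ) :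
    IsPseudoMoment g k (truncatedMoments (2 * k) L) := by
  refine isPseudoMoment_iff.2 ⟨fun a ha => if_neg (by lia), fun h hh => ?_, fun i hi h hh => ?_⟩
  · rw [rieszLinear_truncatedMoments _ (totalDegree_mul_self_le hh)]
    exact hL _ ((isQuadraticModule_quadraticModule g).mul_self_mem h)
  · rw [rieszLinear_truncatedMoments _ (totalDegree_mul_self_mul_le hi hh)]
    exact hL _ (mul_mem_quadraticModule (.mul_self h) i)

end PseudoMoment

/-! ### Positivity of pseudo-moments on the truncated quadratic module -/

section LeadingForm

variable {σ : Type*}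

theorem eval_smul_of_isHomogeneous {R : Type*} [CommSemiring R] {p : MvPolynomial σ R} {d : ℕ}
    (hp : p.IsHomogeneous d) (s : R) (z : σ → R) : eval (s • z) p = s ^ d * eval z p := by
  rw [eval_eq, eval_eq, Finset.mul_sum]
  refine Finset.sum_congr rfl fun a ha => ?_
  simp only [Pi.smul_apply, smul_eq_mul, mul_pow, Finset.prod_mul_distrib]
  rw [Finset.prod_pow_eq_pow_sum, ← Finsupp.degree_apply, hp.degree_eq_sum_deg_support ha,
    Finsupp.degree_apply]
  ring

theorem eval_homogeneousComponent_nonneg {p : MvPolynomial σ ℝ} (hp : ∀ z, 0 ≤ eval z p) {d : ℕ}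
    (hd : p.totalDegree ≤ d) (z : σ → ℝ) : 0 ≤ eval z (homogeneousComponent d p) := by
  let reversed (s : ℝ) : ℝ :=
    ∑ i ∈ Finset.range (d + 1), s ^ (d - i) * eval z (homogeneousComponent i p)
  have reversed_eq : ∀ s > 0, reversed s = s ^ d * eval (s⁻¹ • z) p := by
    intro s hs
    have eval_eq_sum : eval (s⁻¹ • z) p =
        ∑ i ∈ Finset.range (d + 1), eval (s⁻¹ • z) (homogeneousComponent i p) := by
      conv_lhs => rw [← sum_homogeneousComponent p, map_sum]
      refine Finset.sum_subset (Finset.range_mono (by lia)) fun i _ hi => ?_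
      rw [homogeneousComponent_eq_zero _ _ (by simpa using hi), map_zero]
    rw [eval_eq_sum, Finset.mul_sum]
    refine Finset.sum_congr rfl fun i hi => ?_
    rw [eval_smul_of_isHomogeneous (homogeneousComponent_isHomogeneous i p), ← mul_assoc, inv_pow,
      pow_sub₀ s hs.ne' (by simpa [Nat.lt_succ_iff] using hi)]
  have reversed_zero : reversed 0 = eval z (homogeneousComponent d p) := by
    simp only [reversed]
    rw [Finset.sum_range_succ, Finset.sum_eq_zero fun i hi => ?_]
    · simp
    · rw [zero_pow (by have := Finset.mem_range.1 hi; lia), zero_mul]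
  have reversed_tendsto : Tendsto reversed (𝓝[>] 0) (𝓝 (reversed 0)) :=
    (Continuous.tendsto (by fun_prop) 0).mono_left nhdsWithin_le_nhds
  rw [← reversed_zero]
  refine ge_of_tendsto reversed_tendsto (eventually_mem_nhdsWithin.mono fun s hs => ?_)
  rw [reversed_eq s hs]
  exact mul_nonneg (pow_nonneg (le_of_lt hs) d) (hp _)

theorem homogeneousComponent_totalDegree_ne_zero {R : Type*} [CommSemiring R]
    {p : MvPolynomial σ R} (hp : p ≠ 0) : homogeneousComponent p.totalDegree p ≠ 0 := by
  obtain ⟨a, ha, degree_eq⟩ := p.support.exists_mem_eq_sup (support_nonempty.2 hp) Finsupp.degree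
  refine ne_zero_iff.2 ⟨a, ?_⟩
  have ha_degree : a.degree = p.totalDegree := degree_eq.symm
  simpa only [coeff_homogeneousComponent, ha_degree, if_true] using mem_support_iff.1 ha

theorem totalDegree_le_totalDegree_add {p q : MvPolynomial σ ℝ} (hp : ∀ z, 0 ≤ eval z p)
    (hq : ∀ z, 0 ≤ eval z q) : p.totalDegree ≤ (p + q).totalDegree := by
  by_contra! hlt
  obtain ⟨d, hd⟩ : ∃ d, max p.totalDegree q.totalDegree = d := ⟨_, rfl⟩
  have sum_eq_zero (z : σ → ℝ) :
      eval z (homogeneousComponent d p) + eval z (homogeneousComponent d q) = 0 := by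
    rw [← map_add, ← map_add, homogeneousComponent_eq_zero _ _ (by lia), map_zero]
  have p_nonneg := eval_homogeneousComponent_nonneg hp (d := d) (by lia)
  have q_nonneg := eval_homogeneousComponent_nonneg hq (d := d) (by lia)
  have hp_zero : homogeneousComponent d p = 0 :=
    MvPolynomial.funext fun z => by rw [map_zero]; linarith [sum_eq_zero z, p_nonneg z, q_nonneg z]
  have hq_zero : homogeneousComponent d q = 0 :=
    MvPolynomial.funext fun z => by rw [map_zero]; linarith [sum_eq_zero z, p_nonneg z, q_nonneg z]
  rcases max_choice p.totalDegree q.totalDegree with h | h <;> rw [h] at hd <;> subst hd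
  · exact homogeneousComponent_totalDegree_ne_zero (by rintro rfl; simp at hlt) hp_zero
  · refine homogeneousComponent_totalDegree_ne_zero ?_ hq_zero
    rintro rfl
    simp at h hlt

end LeadingForm

section Positivity

variable {σ ι : Type*} {y : (σ →₀ ℕ) → ℝ}

theorem rieszLinear_mul_nonneg_of_isSumSq {p : MvPolynomial σ ℝ} {d : ℕ}
    (hy : ∀ h : MvPolynomial σ ℝ, h.totalDegree ≤ d → 0 ≤ rieszLinear y (h * h * p))
    {q : MvPolynomial σ ℝ} (hq : IsSumSq q) (hd : q.totalDegree ≤ 2 * d + 1) :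
    0 ≤ rieszLinear y (q * p) := by
  induction hq with
  | zero => simp
  | @sq_add a s hs ih =>
    have square_le := totalDegree_le_totalDegree_add (eval_nonneg_of_isSumSq (.mul_self a))
      (eval_nonneg_of_isSumSq hs)
    have rest_le := totalDegree_le_totalDegree_add (eval_nonneg_of_isSumSq hs)
      (eval_nonneg_of_isSumSq (.mul_self a))
    rw [add_comm s] at rest_le
    rw [add_mul, map_add]
    refine add_nonneg (hy a ?_) (ih (rest_le.trans hd))
    rcases eq_or_ne a 0 with rfl | ha
    · simp
    · rw [totalDegree_mul_of_isDomain ha ha] at square_le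
      lia

theorem IsPseudoMoment.rieszLinear_nonneg [Fintype ι] {g : ι → MvPolynomial σ ℝ} {k : ℕ}
    (hy : IsPseudoMoment g k y) {p : MvPolynomial σ ℝ} (hp : InQuadraticModule g k p) :
    0 ≤ rieszLinear y p := by
  obtain ⟨-, moment_nonneg, localizing_nonneg⟩ := isPseudoMoment_iff.1 hy
  obtain ⟨q₀, q, hq₀, hd₀, hq, rfl⟩ := hp
  rw [map_add, map_sum]
  refine add_nonneg ?_ (Finset.sum_nonneg fun i _ => ?_)
  · rw [← mul_one q₀]
    exact rieszLinear_mul_nonneg_of_isSumSq (d := k) (by simpa using moment_nonneg) hq₀ (by lia)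
  · rcases eq_or_ne (q i * g i) 0 with h0 | h0
    · simp [h0]
    · have hdeg := (hq i).2
      rw [totalDegree_mul_of_isDomain (left_ne_zero_of_mul h0) (right_ne_zero_of_mul h0)] at hdeg
      refine rieszLinear_mul_nonneg_of_isSumSq (localizing_nonneg i ?_) (hq i).1 ?_ <;>
        rw [halfDegree] at * <;> lia

end Positivity

/-! ### Ball constraints bound pseudo-moments -/

section Bounds

variable {σ ι : Type*} {g : ι → MvPolynomial σ ℝ} {k : ℕ} {y : (σ →₀ ℕ) → ℝ}

/-- Every variable `xⱼ` occurs in a constraint `R² - ∑_{l ∈ s} xₗ² ≥ 0`. In contrast to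
`HasBallConstraint`, this covers boxes and is inherited by products. -/
def HasBallCover (g : ι → MvPolynomial σ ℝ) : Prop :=
  ∀ j, ∃ i, ∃ (R : ℝ) (s : Finset σ), j ∈ s ∧ g i = C (R ^ 2) - ∑ l ∈ s, X l ^ 2

theorem HasBallConstraint.hasBallCover [Fintype σ] (hg : HasBallConstraint g) :
    HasBallCover g :=
  let ⟨i, R, hi⟩ := hg
  fun j => ⟨i, R, Finset.univ, Finset.mem_univ j, hi⟩

theorem HasBallCover.productConstraints {n m nX nU : ℕ} {gX : Fin nX → MvPolynomial (Fin n) ℝ}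
    {gU : Fin nU → MvPolynomial (Fin m) ℝ} (hX : HasBallCover gX) (hU : HasBallCover gU) :
    HasBallCover (productConstraints gX gU) := by
  rintro (j | j)
  · obtain ⟨i, R, s, hj, hi⟩ := hX j
    exact ⟨.inl i, R, s.map .inl, by simpa using hj, by simp [MCI.productConstraints, hi]⟩
  · obtain ⟨i, R, s, hj, hi⟩ := hU j
    exact ⟨.inr i, R, s.map .inr, by simpa using hj, by simp [MCI.productConstraints, hi]⟩

theorem HasBallCover.boundsCoordinates [Fintype ι] (hg : HasBallCover g) :
    BoundsCoordinates g := by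
  classical
  intro j
  obtain ⟨i, R, s, hj, hi⟩ := hg j
  have decomposition : C (R ^ 2) - X j * X j = g i + ∑ l ∈ s.erase j, X l * X l := by
    rw [hi, ← Finset.add_sum_erase _ _ hj]
    simp only [sq]
    ring
  refine ⟨R ^ 2, decomposition ▸ add_mem (mem_quadraticModule_self i) (sum_mem fun l _ => ?_)⟩
  exact (isQuadraticModule_quadraticModule g).mul_self_mem (X l)

theorem IsPseudoMoment.rieszLinear_mul_X_sq_le (hy : IsPseudoMoment g k y) {i : ι} {R : ℝ}
    {s : Finset σ} {j : σ} (hj : j ∈ s) (hi : g i = C (R ^ 2) - ∑ l ∈ s, X l ^ 2)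
    {h : MvPolynomial σ ℝ} (hh : h.totalDegree + 1 ≤ k) :
    rieszLinear y (h * X j * (h * X j)) ≤ R ^ 2 * rieszLinear y (h * h) := by
  classical
  obtain ⟨-, moment_nonneg, localizing_nonneg⟩ := isPseudoMoment_iff.1 hy
  have degree_le : (g i).totalDegree ≤ 2 := by
    rw [hi]
    refine (totalDegree_sub _ _).trans (max_le (by rw [totalDegree_C]; lia) ?_)
    exact totalDegree_finsetSum_le fun l _ => (totalDegree_X_pow l 2).le
  have ball_nonneg : 0 ≤ rieszLinear y (h * h * g i) :=
    localizing_nonneg i (by rw [halfDegree]; lia) h (by rw [halfDegree]; lia)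
  have others_nonneg : 0 ≤ ∑ l ∈ s.erase j, rieszLinear y (h * X l * (h * X l)) :=
    Finset.sum_nonneg fun l _ => moment_nonneg _ ((totalDegree_mul _ _).trans (by simpa using hh))
  have expansion : h * h * g i = R ^ 2 • (h * h) - h * X j * (h * X j) -
      ∑ l ∈ s.erase j, h * X l * (h * X l) := by
    rw [hi, ← Finset.add_sum_erase _ _ hj, smul_eq_C_mul, mul_sub, mul_add, Finset.mul_sum,
      Finset.sum_congr rfl fun l _ => show h * h * X l ^ 2 = h * X l * (h * X l) by ring]
    ring
  rw [expansion, map_sub, map_sub, map_smul, smul_eq_mul, map_sum] at ball_nonneg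
  linarith

theorem rieszLinear_monomial_mul_monomial (y : (σ →₀ ℕ) → ℝ) (a b : σ →₀ ℕ) :
    rieszLinear y (monomial a 1 * monomial b 1) = y (a + b) := by
  rw [monomial_mul, rieszLinear_monomial, one_mul, one_mul]

theorem IsPseudoMoment.apply_add_self_nonneg (hy : IsPseudoMoment g k y) {a : σ →₀ ℕ}
    (ha : a.degree ≤ k) : 0 ≤ y (a + a) := by
  rw [← rieszLinear_monomial_mul_monomial y]
  exact (isPseudoMoment_iff.1 hy).2.1 _ ((totalDegree_monomial_le a 1).trans ha)

theorem IsPseudoMoment.apply_zero_nonneg (hy : IsPseudoMoment g k y) : 0 ≤ y 0 := by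
  simpa using hy.apply_add_self_nonneg (a := 0) (by simp)

theorem IsPseudoMoment.two_mul_abs_apply_add_le (hy : IsPseudoMoment g k y) {a b : σ →₀ ℕ}
    (ha : a.degree ≤ k) (hb : b.degree ≤ k) : 2 * |y (a + b)| ≤ y (a + a) + y (b + b) := by
  have ha' := (totalDegree_monomial_le a (1 : ℝ)).trans ha
  have hb' := (totalDegree_monomial_le b (1 : ℝ)).trans hb
  obtain ⟨-, moment_nonneg, -⟩ := isPseudoMoment_iff.1 hy
  have add_nonneg := moment_nonneg (monomial a 1 + monomial b 1)
    ((totalDegree_add _ _).trans (max_le ha' hb'))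
  have sub_nonneg := moment_nonneg (monomial a 1 - monomial b 1)
    ((totalDegree_sub _ _).trans (max_le ha' hb'))
  simp only [add_mul, mul_add, sub_mul, mul_sub, map_add, map_sub,
    rieszLinear_monomial_mul_monomial, add_comm b a] at add_nonneg sub_nonneg
  rw [← abs_two, ← abs_mul, abs_le]
  constructor <;> linarith

theorem IsPseudoMoment.apply_add_self_le (hy : IsPseudoMoment g k y) {ρ : ℝ}
    (hρ : ∀ j, ∃ i, ∃ (R : ℝ) (s : Finset σ), R ^ 2 ≤ ρ ∧ j ∈ s ∧
      g i = C (R ^ 2) - ∑ l ∈ s, X l ^ 2) {a : σ →₀ ℕ} (ha : a.degree ≤ k) :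
    y (a + a) ≤ ρ ^ a.degree * y 0 := by
  obtain ⟨d, hd⟩ : ∃ d, a.degree = d := ⟨_, rfl⟩
  induction d generalizing a with
  | zero =>
    rw [Finsupp.degree_eq_zero_iff] at hd
    simp [hd]
  | succ d ih =>
    have ha_ne : a ≠ 0 := by
      rintro rfl
      simp at hd
    obtain ⟨j, hj⟩ := Finsupp.ne_iff.1 ha_ne
    obtain ⟨b, rfl⟩ : ∃ b, a = b + Finsupp.single j 1 := ⟨a - .single j 1,
      (tsub_add_cancel_of_le (Finsupp.single_le_iff.2 (Nat.one_le_iff_ne_zero.2 hj))).symm⟩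
    rw [map_add, Finsupp.degree_single] at ha hd ⊢
    obtain ⟨i, R, s, hR, hjs, hi⟩ := hρ j
    have step := hy.rieszLinear_mul_X_sq_le hjs hi (h := monomial b 1)
      ((Nat.succ_le_succ (totalDegree_monomial_le b 1)).trans ha)
    rw [X, monomial_mul, one_mul, rieszLinear_monomial_mul_monomial,
      rieszLinear_monomial_mul_monomial] at step
    calc y (b + .single j 1 + (b + .single j 1)) ≤ R ^ 2 * y (b + b) := step
      _ ≤ ρ * (ρ ^ b.degree * y 0) := mul_le_mul hR (ih (by lia) (by lia))
        (hy.apply_add_self_nonneg (by lia)) ((sq_nonneg R).trans hR)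
      _ = ρ ^ (b.degree + 1) * y 0 := by ring

theorem HasBallCover.exists_pseudoMoment_bound [Finite σ] (hg : HasBallCover g) (k : ℕ) :
    ∃ B : ℝ, 0 ≤ B ∧ ∀ y, IsPseudoMoment g k y → ∀ a, |y a| ≤ B * y 0 := by
  choose i R s hj hi using hg
  obtain ⟨ρ, hρ⟩ := (Set.finite_range fun j => R j ^ 2).bddAbove
  replace hρ (j) : R j ^ 2 ≤ max 1 ρ := (hρ ⟨j, rfl⟩).trans (le_max_right _ _)
  refine ⟨max 1 ρ ^ k, by positivity, fun y hy a => ?_⟩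
  have diagonal_le {b : σ →₀ ℕ} (hb : b.degree ≤ k) : y (b + b) ≤ max 1 ρ ^ k * y 0 :=
    (hy.apply_add_self_le (fun j => ⟨i j, R j, s j, hρ j, hj j, hi j⟩) hb).trans <|
      mul_le_mul_of_nonneg_right (pow_le_pow_right₀ (le_max_left _ _) hb) hy.apply_zero_nonneg
  have sum_le {b c : σ →₀ ℕ} (hb : b.degree ≤ k) (hc : c.degree ≤ k) :
      |y (b + c)| ≤ max 1 ρ ^ k * y 0 := by
    linarith [hy.two_mul_abs_apply_add_le hb hc, diagonal_le hb, diagonal_le hc]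
  rcases le_or_gt a.degree k with ha | ha
  · simpa using sum_le ha (c := 0) (by simp)
  rcases le_or_gt a.degree (2 * k) with ha' | ha'
  · obtain ⟨b, hba, hb⟩ := Finsupp.exists_le_degree_eq a k ha.le
    obtain ⟨c, rfl⟩ := exists_add_of_le hba
    rw [map_add] at ha'
    exact sum_le hb.le (by lia)
  · rw [(isPseudoMoment_iff.1 hy).1 a ha', abs_zero]
    exact mul_nonneg (by positivity) hy.apply_zero_nonneg

end Bounds

/-! ### The hierarchy -/

section Hierarchy

variable {n m nX nU : ℕ} {A : MvPolynomial (Fin n) ℝ → MvPolynomial (Fin n ⊕ Fin m) ℝ}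
  {gX : Fin nX → MvPolynomial (Fin n) ℝ} {gU : Fin nU → MvPolynomial (Fin m) ℝ}

theorem setIntegral_eval_nonneg {p : MvPolynomial (Fin n) ℝ} (hp : p ∈ quadraticModule gX) :
    0 ≤ ∫ x in semialgSet gX, eval x p :=
  setIntegral_nonneg (isClosed_semialgSet gX).measurableSet
    fun _ hx => eval_nonneg_of_mem_quadraticModule hp hx

theorem dualApproximationValues_mono {k l r s : ℕ} (hkl : k ≤ l) (hrs : r ≤ s) :
    dualApproximationValues A gX gU k r ⊆ dualApproximationValues A gX gU l s := by
  rintro c ⟨v, w, hv, hw, decay, super, nonneg, rfl⟩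
  exact ⟨v, w, by lia, by lia, decay.mono hrs, super.mono hkl, nonneg.mono hkl, rfl⟩

theorem dualApproximationValues_nonempty (hA : A 0 = 0) (k r : ℕ) :
    (dualApproximationValues A gX gU k r).Nonempty := by
  refine ⟨_, 0, 1, by simp, by simp, ?_, ?_, ?_, rfl⟩
  · exact ⟨0, 0, .zero, by simp, fun i => ⟨.zero, by simp⟩, by simp [hA]⟩
  · exact ⟨0, 0, .zero, by simp, fun i => ⟨.zero, by simp⟩, by simp⟩
  · exact ⟨1, 0, .one, by simp, fun i => ⟨.zero, by simp⟩, by simp⟩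

theorem primalRelaxationValues_antitone {k l r s : ℕ} (hkl : k ≤ l) (hrs : r ≤ s) :
    primalRelaxationValues A gX gU l s ⊆ primalRelaxationValues A gX gU k r := by
  rintro c ⟨y, y₀, y₀', hy, hy₀, hy₀', dynamics, split, rfl⟩
  refine ⟨_, _, _, hy.truncate hrs, hy₀.truncate hkl, hy₀'.truncate hkl, fun v hv hAv => ?_,
    fun w hw => ?_, ?_⟩
  · rw [← rieszLinear_apply, ← rieszLinear_apply, rieszLinear_truncatedMoments _ hAv,
      rieszLinear_truncatedMoments _ hv, rieszLinear_apply, rieszLinear_apply]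
    exact dynamics v (by lia) (by lia)
  · rw [← rieszLinear_apply, ← rieszLinear_apply, rieszLinear_truncatedMoments _ hw,
      rieszLinear_truncatedMoments _ hw, rieszLinear_apply, rieszLinear_apply]
    exact split w (by lia)
  · simp [truncatedMoments, rieszLinear_one]

theorem primalRelaxationValues_le_dualApproximationValues {k r : ℕ} {p d : ℝ}
    (hp : p ∈ primalRelaxationValues A gX gU k r) (hd : d ∈ dualApproximationValues A gX gU k r) :
    p ≤ d := by
  obtain ⟨y, y₀, y₀', hy, hy₀, hy₀', dynamics, split, rfl⟩ := hp
  obtain ⟨v, w, hv, hw, decay, super, nonneg, rfl⟩ := hd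
  have decay_nonneg := hy.rieszLinear_nonneg decay
  have super_nonneg := hy₀.rieszLinear_nonneg super
  have slack_nonneg := hy₀'.rieszLinear_nonneg nonneg
  rw [rieszLinear_apply, dynamics v hv decay.totalDegree_le] at decay_nonneg
  rw [map_sub, map_sub, rieszLinear_one, rieszLinear_apply, rieszLinear_apply] at super_nonneg
  rw [rieszLinear_apply] at slack_nonneg
  linarith [split w hw]

variable (A gX gU) in
/-- The feasible points `(y, y₀, ŷ₀)` of the primal moment relaxation. -/
def feasiblePseudoMoments (k r : ℕ) :
    Set (((Fin n ⊕ Fin m →₀ ℕ) → ℝ) × ((Fin n →₀ ℕ) → ℝ) × ((Fin n →₀ ℕ) → ℝ)) :=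
  {z | IsPseudoMoment (productConstraints gX gU) r z.1 ∧
    IsPseudoMoment gX k z.2.1 ∧ IsPseudoMoment gX k z.2.2 ∧
    (∀ v : MvPolynomial (Fin n) ℝ, v.totalDegree ≤ 2 * k → (A v).totalDegree ≤ 2 * r →
      rieszLinear z.1 (A v) = rieszLinear z.2.1 v) ∧
    ∀ w : MvPolynomial (Fin n) ℝ, w.totalDegree ≤ 2 * k →
      rieszLinear z.2.1 w + rieszLinear z.2.2 w = rieszLinear (lebesgueMoment (semialgSet gX)) w}

theorem image_feasiblePseudoMoments (k r : ℕ) :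
    (fun z => z.2.1 0) '' feasiblePseudoMoments A gX gU k r =
      primalRelaxationValues A gX gU k r := by
  ext c
  simp only [primalRelaxationValues, feasiblePseudoMoments, rieszLinear_apply, Set.mem_image,
    Set.mem_ofPred_eq, Prod.exists]
  grind

theorem isClosed_feasiblePseudoMoments (k r : ℕ) :
    IsClosed (feasiblePseudoMoments A gX gU k r) := by
  have rieszLinear_comp {σ Z : Type} [TopologicalSpace Z] {y : Z → (σ →₀ ℕ) → ℝ}
      (hy : Continuous y) (p : MvPolynomial σ ℝ) : Continuous fun z => rieszLinear (y z) p :=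
    (continuous_rieszLinear p).comp hy
  simp only [feasiblePseudoMoments, Set.ofPred_and, Set.ofPred_forall]
  refine .inter ((isClosed_isPseudoMoment _ _).preimage (by fun_prop))
    (.inter ((isClosed_isPseudoMoment _ _).preimage (by fun_prop))
    (.inter ((isClosed_isPseudoMoment _ _).preimage (by fun_prop)) (.inter ?_ ?_)))
  · exact isClosed_iInter fun v => isClosed_iInter fun _ => isClosed_iInter fun _ =>
      isClosed_eq (rieszLinear_comp (by fun_prop) _) (rieszLinear_comp (by fun_prop) _)
  · exact isClosed_iInter fun w => isClosed_iInter fun _ =>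
      isClosed_eq ((rieszLinear_comp (by fun_prop) _).add (rieszLinear_comp (by fun_prop) _))
        continuous_const

theorem mass_le_of_mem_feasiblePseudoMoments {δ : ℝ} (hδ : 0 < δ) (hA : A 1 = C δ) {k r : ℕ}
    {y y₀ y₀'} (hy : (y, y₀, y₀') ∈ feasiblePseudoMoments A gX gU k r) :
    y 0 ≤ lebesgueMoment (semialgSet gX) 0 / δ ∧ y₀ 0 ≤ lebesgueMoment (semialgSet gX) 0 ∧
      y₀' 0 ≤ lebesgueMoment (semialgSet gX) 0 := by
  obtain ⟨-, hy₀, hy₀', dynamics, split⟩ := hy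
  have mass_eq : δ * y 0 = y₀ 0 := by
    simpa [hA, ← monomial_zero', rieszLinear_monomial, rieszLinear_one] using
      dynamics 1 (by simp) (by simp [hA])
  have mass_add : y₀ 0 + y₀' 0 = lebesgueMoment (semialgSet gX) 0 := by
    simpa [rieszLinear_one] using split 1 (by simp)
  have mass_nonneg : 0 ≤ y₀ 0 := hy₀.apply_zero_nonneg
  have mass_nonneg' : 0 ≤ y₀' 0 := hy₀'.apply_zero_nonneg
  rw [le_div_iff₀ hδ]
  refine ⟨?_, ?_, ?_⟩ <;> linarith

theorem isCompact_primalRelaxationValues (hX : HasBallCover gX) (hU : HasBallCover gU)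
    {δ : ℝ} (hδ : 0 < δ) (hA : A 1 = C δ) (k r : ℕ) :
    IsCompact (primalRelaxationValues A gX gU k r) := by
  obtain ⟨B, hB_nonneg, hB⟩ := (hX.productConstraints hU).exists_pseudoMoment_bound r
  obtain ⟨B₀, hB₀_nonneg, hB₀⟩ := hX.exists_pseudoMoment_bound k
  rw [← image_feasiblePseudoMoments]
  refine IsCompact.image ?_ (by fun_prop)
  set ℓ := lebesgueMoment (semialgSet gX) 0
  have box_compact (ι : Type) (c : ℝ) : IsCompact (Set.univ.pi fun _ : ι => Set.Icc (-c) c) :=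
    isCompact_univ_pi fun _ => isCompact_Icc
  refine ((box_compact _ (B * (ℓ / δ))).prod ((box_compact _ (B₀ * ℓ)).prod
    (box_compact _ (B₀ * ℓ)))).of_isClosed_subset (isClosed_feasiblePseudoMoments k r) ?_
  rintro ⟨y, y₀, y₀'⟩ feasible
  obtain ⟨mass_le, mass_le₀, mass_le₀'⟩ := mass_le_of_mem_feasiblePseudoMoments hδ hA feasible
  obtain ⟨hy, hy₀, hy₀', -, -⟩ := feasible
  exact ⟨fun a _ => abs_le.1 ((hB y hy a).trans (by gcongr)),
    fun a _ => abs_le.1 ((hB₀ y₀ hy₀ a).trans (by gcongr)),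
    fun a _ => abs_le.1 ((hB₀ y₀' hy₀' a).trans (by gcongr))⟩

variable (A gX gU) in
/-- Objective values of the dual sum-of-squares problem without bounds on the degrees. -/
def dualPolynomialValues : Set ℝ :=
  {c | ∃ v w : MvPolynomial (Fin n) ℝ, A v ∈ quadraticModule (productConstraints gX gU) ∧
    w - v - 1 ∈ quadraticModule gX ∧ w ∈ quadraticModule gX ∧
    c = ∫ x in semialgSet gX, eval x w}

theorem nonneg_of_mem_dualPolynomialValues {c : ℝ} (hc : c ∈ dualPolynomialValues A gX gU) :
    0 ≤ c := by
  obtain ⟨v, w, -, -, hw, rfl⟩ := hc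
  exact setIntegral_eval_nonneg hw

theorem iUnion_dualApproximationValues (hK : IsCompact (semialgSet gX)) {r : ℕ → ℕ}
    (hkr : ∀ k, k ≤ r k) :
    ⋃ k, dualApproximationValues A gX gU k (r k) = dualPolynomialValues A gX gU := by
  ext c
  simp only [Set.mem_iUnion]
  constructor
  · rintro ⟨k, v, w, -, -, decay, super, nonneg, rfl⟩
    exact ⟨v, w, decay.mem_quadraticModule, super.mem_quadraticModule, nonneg.mem_quadraticModule,
      by rw [← rieszLinear_apply, rieszLinear_lebesgueMoment hK]⟩
  · rintro ⟨v, w, decay, super, nonneg, rfl⟩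
    obtain ⟨k₁, decay⟩ := exists_inQuadraticModule decay
    obtain ⟨k₂, super⟩ := exists_inQuadraticModule super
    obtain ⟨k₃, nonneg⟩ := exists_inQuadraticModule nonneg
    have hkr := hkr (k₁ + k₂ + k₃ + v.totalDegree + w.totalDegree)
    exact ⟨k₁ + k₂ + k₃ + v.totalDegree + w.totalDegree, v, w, by lia, by lia,
      decay.mono (by lia), super.mono (by lia), nonneg.mono (by lia),
      by rw [← rieszLinear_apply, rieszLinear_lebesgueMoment hK]⟩

variable (A gX gU) in
/-- Feasibility of linear functionals `L`, `L₀`, `L₀'` on all polynomials, which stand for the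
integrals against `μ`, `μ₀`, `μ̂₀`. -/
structure AreFeasibleFunctionals (L : MvPolynomial (Fin n ⊕ Fin m) ℝ →ₗ[ℝ] ℝ)
    (L₀ L₀' : MvPolynomial (Fin n) ℝ →ₗ[ℝ] ℝ) : Prop where
  nonneg : ∀ p ∈ quadraticModule (productConstraints gX gU), 0 ≤ L p
  nonneg_initial : ∀ p ∈ quadraticModule gX, 0 ≤ L₀ p
  nonneg_slack : ∀ p ∈ quadraticModule gX, 0 ≤ L₀' p
  dynamics : ∀ v, L (A v) = L₀ v
  split : ∀ w, L₀ w + L₀' w = ∫ x in semialgSet gX, eval x w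

theorem AreFeasibleFunctionals.mem_primalRelaxationValues
    {L : MvPolynomial (Fin n ⊕ Fin m) ℝ →ₗ[ℝ] ℝ} {L₀ L₀' : MvPolynomial (Fin n) ℝ →ₗ[ℝ] ℝ}
    (hL : AreFeasibleFunctionals A gX gU L L₀ L₀') (hK : IsCompact (semialgSet gX)) (k r : ℕ) :
    L₀ 1 ∈ primalRelaxationValues A gX gU k r := by
  refine ⟨_, _, _, isPseudoMoment_truncatedMoments hL.nonneg r,
    isPseudoMoment_truncatedMoments hL.nonneg_initial k,
    isPseudoMoment_truncatedMoments hL.nonneg_slack k, fun v hv hAv => ?_, fun w hw => ?_, ?_⟩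
  · rw [← rieszLinear_apply, ← rieszLinear_apply, rieszLinear_truncatedMoments _ hAv,
      rieszLinear_truncatedMoments _ hv, hL.dynamics]
  · rw [← rieszLinear_apply, ← rieszLinear_apply, ← rieszLinear_apply,
      rieszLinear_truncatedMoments _ hw, rieszLinear_truncatedMoments _ hw, hL.split,
      rieszLinear_lebesgueMoment hK]
  · simp [truncatedMoments]

/-- The linear map `(v, w) ↦ (A v, w - v, w)` of the dual problem, whose constraints say that its
values minus `(0, 1, 0)` lie in a product of quadratic modules. -/
def dualConstraintMap (A : MvPolynomial (Fin n) ℝ →ₗ[ℝ] MvPolynomial (Fin n ⊕ Fin m) ℝ) :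
    MvPolynomial (Fin n) ℝ × MvPolynomial (Fin n) ℝ →ₗ[ℝ]
      MvPolynomial (Fin n ⊕ Fin m) ℝ × MvPolynomial (Fin n) ℝ × MvPolynomial (Fin n) ℝ :=
  (A ∘ₗ .fst ℝ _ _).prod (.prod (.snd ℝ _ _ - .fst ℝ _ _) (.snd ℝ _ _))

theorem dualConstraintMap_apply
    (A : MvPolynomial (Fin n) ℝ →ₗ[ℝ] MvPolynomial (Fin n ⊕ Fin m) ℝ)
    (v w : MvPolynomial (Fin n) ℝ) : dualConstraintMap A (v, w) = (A v, w - v, w) :=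
  rfl

theorem exists_dualConstraintMap_add_mem
    {A : MvPolynomial (Fin n) ℝ →ₗ[ℝ] MvPolynomial (Fin n ⊕ Fin m) ℝ} {δ : ℝ} (hδ : 0 < δ)
    (hA : A 1 = C δ) {M : PointedCone ℝ (MvPolynomial (Fin n ⊕ Fin m) ℝ)}
    {N : PointedCone ℝ (MvPolynomial (Fin n) ℝ)} (hM : IsArchimedean M) (hN : IsArchimedean N) (e) :
    ∃ d, dualConstraintMap A d + e ∈ M.prod (N.prod N) := by
  obtain ⟨a, b, c⟩ := e
  obtain ⟨k₁, hk₁, ha⟩ := hM.exists_nonneg_bound (-a)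
  obtain ⟨k₂, hk₂, hb⟩ := hN.exists_nonneg_bound (-b)
  obtain ⟨k₃, hk₃, hc⟩ := hN.exists_nonneg_bound (-c)
  rw [algebraMap_eq, sub_neg_eq_add] at ha hb hc
  have A_const : A (C (k₁ / δ)) = C k₁ := by
    rw [← mul_one (C _), ← smul_eq_C_mul, map_smul, hA, smul_eq_C_mul, ← C_mul,
      div_mul_cancel₀ _ hδ.ne']
  have super_mem : C (k₁ / δ + k₂ + k₃) - C (k₁ / δ) + b ∈ N := by
    convert add_mem hb (hN.algebraMap_mem hk₃) using 1
    simp only [C_add, algebraMap_eq]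
    ring
  have nonneg_mem : C (k₁ / δ + k₂ + k₃) + c ∈ N := by
    convert add_mem hc (hN.algebraMap_mem (add_nonneg (div_nonneg hk₁ hδ.le) hk₂)) using 1
    simp only [C_add, algebraMap_eq]
    ring
  refine ⟨(C (k₁ / δ), C (k₁ / δ + k₂ + k₃)), ?_⟩
  rw [dualConstraintMap_apply, A_const]
  exact ⟨ha, super_mem, nonneg_mem⟩

theorem exists_areFeasibleFunctionals
    {A : MvPolynomial (Fin n) ℝ →ₗ[ℝ] MvPolynomial (Fin n ⊕ Fin m) ℝ} (hX : BoundsCoordinates gX)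
    (hXU : BoundsCoordinates (productConstraints gX gU)) {δ : ℝ} (hδ : 0 < δ) (hA : A 1 = C δ)
    {γ : ℝ} (hγ : IsGLB (dualPolynomialValues A gX gU) γ) :
    ∃ L L₀ L₀', AreFeasibleFunctionals A gX gU L L₀ L₀' ∧ L₀ 1 = γ := by
  have values_eq : dualPolynomialValues A gX gU = {c | ∃ d, dualConstraintMap A d - (0, 1, 0) ∈
      (quadraticModule (productConstraints gX gU)).prod
        ((quadraticModule gX).prod (quadraticModule gX)) ∧
      c = (rieszLinear (lebesgueMoment (semialgSet gX)) ∘ₗ LinearMap.snd ℝ _ _) d} := by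
    ext c
    simp [dualConstraintMap_apply, dualPolynomialValues, Submodule.mem_prod,
      rieszLinear_lebesgueMoment hX.isCompact, and_assoc]
  rw [values_eq] at hγ
  obtain ⟨g, g_nonneg, g_map, g_target⟩ := exists_dual_optimal _ _ _ _
    (exists_dualConstraintMap_add_mem hδ hA hXU.isArchimedean hX.isArchimedean) hγ
  refine ⟨g ∘ₗ .inl ℝ _ _, g ∘ₗ .inr ℝ _ _ ∘ₗ .inl ℝ _ _, g ∘ₗ .inr ℝ _ _ ∘ₗ .inr ℝ _ _, ⟨
    fun p hp => g_nonneg _ ⟨hp, zero_mem _, zero_mem _⟩,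
    fun p hp => g_nonneg _ ⟨zero_mem _, hp, zero_mem _⟩,
    fun p hp => g_nonneg _ ⟨zero_mem _, zero_mem _, hp⟩, fun v => ?_, fun w => ?_⟩, g_target⟩
  · rw [← sub_eq_zero]
    simpa [dualConstraintMap_apply, ← map_sub] using g_map (v, 0)
  · simpa [dualConstraintMap_apply, ← map_add, rieszLinear_lebesgueMoment hX.isCompact] using
      g_map (0, w)

end Hierarchy

section Convergence

variable {Dinf Pinf : Set ℝ} {D P : ℕ → Set ℝ} {γ : ℝ}

theorem tendsto_sInf_of_monotone (D_mono : Monotone D) (D_nonempty : ∀ k, (D k).Nonempty)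
    (hγ : IsGLB (⋃ k, D k) γ) : Tendsto (fun k => sInf (D k)) atTop (𝓝 γ) := by
  have γ_le (k) : ∀ c ∈ D k, γ ≤ c := fun c hc => hγ.1 (Set.mem_iUnion_of_mem k hc)
  refine tendsto_order.2 ⟨fun a ha => .of_forall fun k =>
    ha.trans_le (le_csInf (D_nonempty k) (γ_le k)), fun a ha => ?_⟩
  obtain ⟨c, hc, hca⟩ := (isGLB_lt_iff hγ).1 ha
  obtain ⟨k₀, hk₀⟩ := Set.mem_iUnion.1 hc
  filter_upwards [eventually_ge_atTop k₀] with k hk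
  exact (csInf_le ⟨γ, γ_le k⟩ (D_mono hk hk₀)).trans_lt hca

theorem valuesConverge_of_isGLB_iUnion (D_mono : Monotone D) (D_nonempty : ∀ k, (D k).Nonempty)
    (D_subset : ∀ k, D k ⊆ Dinf) (P_anti : Antitone P) (P_compact : ∀ k, IsCompact (P k))
    (hγ : IsGLB (⋃ k, D k) γ) (γ_mem : γ ∈ Pinf) (γ_mem_relaxation : ∀ k, γ ∈ P k)
    (weak : ∀ p ∈ Pinf, ∀ d ∈ Dinf, p ≤ d)
    (weak_relaxation : ∀ k, ∀ p ∈ P k, ∀ d ∈ D k, p ≤ d) : ValuesConverge Dinf D Pinf P := by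
  have D_glb (k) : IsGLB (D k) (sInf (D k)) :=
    isGLB_csInf (D_nonempty k) ⟨γ, weak_relaxation k γ (γ_mem_relaxation k)⟩
  have γ_le (k) : γ ≤ sInf (D k) := (D_glb k).2 (weak_relaxation k γ (γ_mem_relaxation k))
  have D_tendsto := tendsto_sInf_of_monotone D_mono D_nonempty hγ
  have iUnion_subset : ⋃ k, D k ⊆ Dinf := Set.iUnion_subset D_subset
  choose p hp using fun k => (P_compact k).exists_isGreatest ⟨γ, γ_mem_relaxation k⟩
  have le_p (k) : γ ≤ p k := (hp k).2 (γ_mem_relaxation k)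
  have p_le (k) : p k ≤ sInf (D k) := (D_glb k).2 (weak_relaxation k _ (hp k).1)
  refine ⟨⟨γ, fun k => sInf (D k), ⟨weak γ γ_mem, fun b hb => ?_⟩, fun k _ => D_glb k,
    fun k _ => ⟨γ_le _, (D_glb k).mono (D_glb (k + 1)) (D_mono k.le_succ)⟩, D_tendsto⟩,
    ⟨γ, p, ⟨γ_mem, fun q hq => ?_⟩, fun k _ => hp k,
    fun k _ => ⟨le_p _, (hp k).2 (P_anti k.le_succ (hp (k + 1)).1)⟩, ?_⟩⟩
  · exact hγ.2 (lowerBounds_mono_set iUnion_subset hb)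
  · exact hγ.2 fun d hd => weak q hq d (iUnion_subset hd)
  · exact tendsto_of_tendsto_of_tendsto_of_le_of_le tendsto_const_nhds D_tendsto le_p p_le

theorem valuesConverge_of_polynomial_feasible {n m nX nU : ℕ}
    {A : MvPolynomial (Fin n) ℝ →ₗ[ℝ] MvPolynomial (Fin n ⊕ Fin m) ℝ}
    {gX : Fin nX → MvPolynomial (Fin n) ℝ} {gU : Fin nU → MvPolynomial (Fin m) ℝ}
    (hX : HasBallCover gX) (hU : HasBallCover gU) {r : ℕ → ℕ} (hr : Monotone r)
    (hkr : ∀ k, k ≤ r k) {δ : ℝ} (hδ : 0 < δ) (hA : A 1 = C δ)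
    (dual_feasible : dualPolynomialValues A gX gU ⊆ Dinf)
    (primal_feasible : ∀ L L₀ L₀', AreFeasibleFunctionals A gX gU L L₀ L₀' → L₀ 1 ∈ Pinf)
    (weak : ∀ p ∈ Pinf, ∀ d ∈ Dinf, p ≤ d) :
    ValuesConverge Dinf (fun k => dualApproximationValues A gX gU k (r k)) Pinf
      (fun k => primalRelaxationValues A gX gU k (r k)) := by
  have iUnion_eq := iUnion_dualApproximationValues (A := A) (gU := gU)
    hX.boundsCoordinates.isCompact hkr
  have values_nonempty : (dualPolynomialValues A gX gU).Nonempty :=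
    iUnion_eq ▸ (dualApproximationValues_nonempty (map_zero A) 0 (r 0)).mono
      (Set.subset_iUnion (fun k => dualApproximationValues A gX gU k (r k)) 0)
  have glb := isGLB_csInf values_nonempty ⟨0, fun _ => nonneg_of_mem_dualPolynomialValues⟩
  obtain ⟨L, L₀, L₀', feasible, optimal⟩ := exists_areFeasibleFunctionals hX.boundsCoordinates
    (hX.productConstraints hU).boundsCoordinates hδ hA glb
  rw [← optimal] at glb
  exact valuesConverge_of_isGLB_iUnion (fun k l hkl => dualApproximationValues_mono hkl (hr hkl))
    (fun k => dualApproximationValues_nonempty (map_zero A) k (r k))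
    (fun k => (Set.subset_iUnion _ k).trans (iUnion_eq.subset.trans dual_feasible))
    (fun k l hkl => primalRelaxationValues_antitone hkl (hr hkl))
    (fun k => isCompact_primalRelaxationValues hX hU hδ hA k (r k)) (iUnion_eq ▸ glb)
    (primal_feasible L L₀ L₀' feasible)
    (fun k => feasible.mem_primalRelaxationValues hX.boundsCoordinates.isCompact k (r k)) weak
    (fun _ _ hp _ hd => primalRelaxationValues_le_dualApproximationValues hp hd)

end Convergence

/-! ### Polynomial approximation in `C¹` -/

section Approximation

variable {n : ℕ} {E : Type*} [NormedAddCommGroup E] [NormedSpace ℝ E]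

theorem integrable_mul_eval_sub {φ : (Fin n → ℝ) → ℝ} (hφ : Continuous φ)
    (φ_supp : HasCompactSupport φ) (q : MvPolynomial (Fin n) ℝ) (x : Fin n → ℝ) :
    Integrable fun y => φ y * eval (x - y) q :=
  (hφ.mul ((continuous_eval q).comp (by fun_prop))).integrable_of_hasCompactSupport
    φ_supp.mul_right

theorem exists_polynomial_eq_convolution {φ : (Fin n → ℝ) → ℝ} (hφ : Continuous φ)
    (φ_supp : HasCompactSupport φ) (q : MvPolynomial (Fin n) ℝ) :
    ∃ p : MvPolynomial (Fin n) ℝ, ∀ x, eval x p = ∫ y, φ y * eval (x - y) q := by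
  induction q using MvPolynomial.induction_on generalizing φ with
  | C a => exact ⟨C (∫ y, φ y * a), by simp⟩
  | add p q hp hq =>
    obtain ⟨p', hp'⟩ := hp hφ φ_supp
    obtain ⟨q', hq'⟩ := hq hφ φ_supp
    refine ⟨p' + q', fun x => ?_⟩
    rw [map_add, hp', hq', ← integral_add (integrable_mul_eval_sub hφ φ_supp p x)
      (integrable_mul_eval_sub hφ φ_supp q x)]
    simp only [map_add, mul_add]
  | mul_X q j hq =>
    have hφ_mul : Continuous fun y => φ y * y j := hφ.mul (continuous_apply j)
    have φ_mul_supp : HasCompactSupport fun y => φ y * y j := φ_supp.mul_right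
    obtain ⟨p₁, hp₁⟩ := hq hφ φ_supp
    obtain ⟨p₂, hp₂⟩ := hq hφ_mul φ_mul_supp
    refine ⟨X j * p₁ - p₂, fun x => ?_⟩
    rw [map_sub, map_mul, eval_X, hp₁, hp₂, ← integral_const_mul,
      ← integral_sub ((integrable_mul_eval_sub hφ φ_supp q x).const_mul _)
        (integrable_mul_eval_sub hφ_mul φ_mul_supp q x)]
    congr 1 with y
    simp only [map_mul, eval_X, Pi.sub_apply]
    ring

/-- A polynomial that is positive on the box of radius `S` and has its only maximum at `0`, so that
its normalized powers concentrate at `0`. -/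
def peakPolynomial (n : ℕ) (S : ℝ) : MvPolynomial (Fin n) ℝ :=
  C (n * S ^ 2 + 1) - ∑ i, X i ^ 2

theorem eval_peakPolynomial (S : ℝ) (t : Fin n → ℝ) :
    eval t (peakPolynomial n S) = n * S ^ 2 + 1 - ∑ i, t i ^ 2 := by
  simp [peakPolynomial]

theorem eval_peakPolynomial_pos {S : ℝ} {t : Fin n → ℝ} (ht : t ∈ Metric.closedBall 0 S) :
    0 < eval t (peakPolynomial n S) := by
  have sum_le : ∑ i, t i ^ 2 ≤ ∑ _i : Fin n, S ^ 2 := Finset.sum_le_sum fun i _ =>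
    sq_le_sq' (neg_le_of_abs_le ((norm_le_pi_norm t i).trans (mem_closedBall_zero_iff.1 ht)))
      ((le_abs_self _).trans ((norm_le_pi_norm t i).trans (mem_closedBall_zero_iff.1 ht)))
  rw [Finset.sum_const, Finset.card_univ, Fintype.card_fin, nsmul_eq_mul] at sum_le
  rw [eval_peakPolynomial]
  linarith

theorem eval_peakPolynomial_lt_eval_zero (S : ℝ) {t : Fin n → ℝ} (ht : t ≠ 0) :
    eval t (peakPolynomial n S) < eval 0 (peakPolynomial n S) := by
  obtain ⟨i, hi⟩ := Function.ne_iff.1 ht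
  have sum_pos : 0 < ∑ i, t i ^ 2 :=
    Finset.sum_pos' (fun _ _ => sq_nonneg _) ⟨i, Finset.mem_univ i, sq_pos_of_ne_zero hi⟩
  rw [eval_peakPolynomial, eval_peakPolynomial]
  simpa using sum_pos

/-- The average of `φ` around `x` with weights proportional to the `k`-th power of the peak
polynomial, normalized by their integral over the box of radius `S` only. -/
def peakAverage (S : ℝ) (k : ℕ) (φ : (Fin n → ℝ) → E) (x : Fin n → ℝ) : E :=
  (∫ t in Metric.closedBall 0 S, eval t (peakPolynomial n S) ^ k)⁻¹ •
    ∫ t, eval t (peakPolynomial n S) ^ k • φ (x - t)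

theorem peakAverage_eq {S a : ℝ} {φ : (Fin n → ℝ) → E}
    (φ_supp : Function.support φ ⊆ Metric.closedBall 0 a) {x : Fin n → ℝ} (hx : ‖x‖ + a ≤ S)
    (k : ℕ) :
    peakAverage S k φ x = (∫ t in Metric.closedBall 0 S, eval t (peakPolynomial n S) ^ k)⁻¹ •
      ∫ t in Metric.closedBall 0 S, eval t (peakPolynomial n S) ^ k • φ (x - t) := by
  rw [peakAverage]
  congr 1
  refine (setIntegral_eq_integral_of_forall_compl_eq_zero fun t ht => ?_).symm
  have φ_eq_zero : φ (x - t) = 0 := by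
    by_contra h
    have norm_le : ‖t - x‖ ≤ a := norm_sub_rev t x ▸ mem_closedBall_zero_iff.1 (φ_supp h)
    rw [mem_closedBall_zero_iff] at ht
    linarith [norm_sub_norm_le t x]
  rw [φ_eq_zero, smul_zero]

theorem tendsto_peakAverage [CompleteSpace E] {S a : ℝ} (hS : 0 < S) {φ : (Fin n → ℝ) → E}
    (hφ : Continuous φ) (φ_supp : Function.support φ ⊆ Metric.closedBall 0 a) {x : Fin n → ℝ}
    (hx : ‖x‖ + a ≤ S) : Tendsto (fun k => peakAverage S k φ x) atTop (𝓝 (φ x)) := by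
  simp only [peakAverage_eq φ_supp hx]
  simpa using tendsto_setIntegral_pow_smul_of_unique_maximum_of_isCompact_of_continuousOn
    (μ := volume) (g := fun t => φ (x - t)) (isCompact_closedBall (0 : Fin n → ℝ) S)
    (continuous_eval (peakPolynomial n S)).continuousOn
    (fun _ _ ht => eval_peakPolynomial_lt_eval_zero S ht)
    (fun _ ht => (eval_peakPolynomial_pos ht).le)
    (eval_peakPolynomial_pos (Metric.mem_closedBall_self hS.le))
    (subset_closure (mem_interior_iff_mem_nhds.2 (Metric.closedBall_mem_nhds _ hS)))
    (hφ.comp (continuous_const.sub continuous_id)).continuousOn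

theorem norm_peakAverage_le {S a B : ℝ} {φ : (Fin n → ℝ) → E} (hB : ∀ y, ‖φ y‖ ≤ B)
    (φ_supp : Function.support φ ⊆ Metric.closedBall 0 a) {x : Fin n → ℝ} (hx : ‖x‖ + a ≤ S)
    (k : ℕ) : ‖peakAverage S k φ x‖ ≤ B := by
  have B_nonneg : 0 ≤ B := (norm_nonneg _).trans (hB 0)
  rw [peakAverage_eq φ_supp hx]
  set s := Metric.closedBall (0 : Fin n → ℝ) S
  set c : (Fin n → ℝ) → ℝ := fun t => eval t (peakPolynomial n S) ^ k
  have s_meas : MeasurableSet s := Metric.isClosed_closedBall.measurableSet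
  have c_integrable : IntegrableOn c s :=
    ((continuous_eval _).pow k).continuousOn.integrableOn_compact (isCompact_closedBall _ _)
  have c_nonneg : ∀ t ∈ s, 0 ≤ c t := fun t ht => pow_nonneg (eval_peakPolynomial_pos ht).le k
  have integral_nonneg : 0 ≤ ∫ t in s, c t := setIntegral_nonneg s_meas c_nonneg
  have norm_integral_le : ‖∫ t in s, c t • φ (x - t)‖ ≤ ∫ t in s, c t * B := by
    refine norm_integral_le_of_norm_le (c_integrable.mul_const B) ?_
    filter_upwards [ae_restrict_mem s_meas] with t ht
    rw [norm_smul, Real.norm_of_nonneg (c_nonneg t ht)]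
    exact mul_le_mul_of_nonneg_left (hB _) (c_nonneg t ht)
  rw [norm_smul, norm_inv, Real.norm_of_nonneg integral_nonneg]
  refine inv_mul_le_of_le_mul₀ integral_nonneg B_nonneg ?_
  rwa [integral_mul_const] at norm_integral_le

theorem exists_polynomial_eq_peakAverage (S : ℝ) (k : ℕ) {φ : (Fin n → ℝ) → ℝ}
    (hφ : Continuous φ) (φ_supp : HasCompactSupport φ) :
    ∃ p : MvPolynomial (Fin n) ℝ, ∀ x, eval x p = peakAverage S k φ x := by
  obtain ⟨p, hp⟩ := exists_polynomial_eq_convolution hφ φ_supp (peakPolynomial n S ^ k)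
  refine ⟨C (∫ t in Metric.closedBall 0 S, eval t (peakPolynomial n S) ^ k)⁻¹ * p, fun x => ?_⟩
  rw [map_mul, eval_C, hp, peakAverage, smul_eq_mul, ← integral_sub_left_eq_self _ volume x]
  simp only [sub_sub_cancel, map_pow, smul_eq_mul, mul_comm]

theorem hasFDerivAt_peakAverage (S : ℝ) (k : ℕ) {φ : (Fin n → ℝ) → ℝ} (hφ : ContDiff ℝ 1 φ)
    (φ_supp : HasCompactSupport φ) (x : Fin n → ℝ) :
    HasFDerivAt (peakAverage S k φ) (peakAverage S k (fderiv ℝ φ) x) x := by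
  have weight_integrable :
      LocallyIntegrable (fun t : Fin n → ℝ => eval t (peakPolynomial n S) ^ k) volume :=
    ((continuous_eval _).pow k).locallyIntegrable
  have hasFDerivAt_convolution := (φ_supp.hasFDerivAt_convolution_left
    (ContinuousLinearMap.lsmul ℝ ℝ) hφ weight_integrable x).const_smul
    (∫ t in Metric.closedBall 0 S, eval t (peakPolynomial n S) ^ k)⁻¹
  convert! hasFDerivAt_convolution using 1
  · funext y
    rw [Pi.smul_apply, convolution_lsmul_swap, peakAverage]
    simp only [smul_eq_mul, mul_comm]
  · rw [convolution_eq_swap, peakAverage]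
    congr 2 with t h
    simp [mul_comm]

/-- On `K` the polynomials `p k` and their derivatives are bounded and converge pointwise to `v` and
its derivative: what dominated convergence requires. -/
structure BoundedlyApproximates (p : ℕ → MvPolynomial (Fin n) ℝ) (v : (Fin n → ℝ) → ℝ)
    (K : Set (Fin n → ℝ)) : Prop where
  tendsto_eval : ∀ x ∈ K, Tendsto (fun k => eval x (p k)) atTop (𝓝 (v x))
  tendsto_fderiv : ∀ x ∈ K,
    Tendsto (fun k => fderiv ℝ (fun z => eval z (p k)) x) atTop (𝓝 (fderiv ℝ v x))
  exists_bound : ∃ B, ∀ k, ∀ x ∈ K, ‖eval x (p k)‖ ≤ B ∧ ‖fderiv ℝ (fun z => eval z (p k)) x‖ ≤ B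

theorem BoundedlyApproximates.congr {p : ℕ → MvPolynomial (Fin n) ℝ} {φ v : (Fin n → ℝ) → ℝ}
    {K : Set (Fin n → ℝ)} (hp : BoundedlyApproximates p φ K) (h : ∀ x ∈ K, φ =ᶠ[𝓝 x] v) :
    BoundedlyApproximates p v K where
  tendsto_eval x hx := (h x hx).eq_of_nhds ▸ hp.tendsto_eval x hx
  tendsto_fderiv x hx := (h x hx).fderiv_eq (𝕜 := ℝ) ▸ hp.tendsto_fderiv x hx
  exists_bound := hp.exists_bound

theorem exists_boundedlyApproximates_of_hasCompactSupport {φ : (Fin n → ℝ) → ℝ}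
    (hφ : ContDiff ℝ 1 φ) (φ_supp : HasCompactSupport φ) {K : Set (Fin n → ℝ)}
    (hK : Bornology.IsBounded K) : ∃ p, BoundedlyApproximates p φ K := by
  have hφ' : Continuous (fderiv ℝ φ) := hφ.continuous_fderiv one_ne_zero
  obtain ⟨ρ, ρ_pos, hρ⟩ := hK.exists_pos_norm_le
  obtain ⟨a, a_pos, ha⟩ := φ_supp.isCompact.isBounded.exists_pos_norm_le
  have φ_ball : tsupport φ ⊆ Metric.closedBall 0 a := fun y hy =>
    mem_closedBall_zero_iff.2 (ha y hy)
  have φ_support : Function.support φ ⊆ Metric.closedBall 0 a := (subset_tsupport φ).trans φ_ball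
  have φ'_support : Function.support (fderiv ℝ φ) ⊆ Metric.closedBall 0 a :=
    (support_fderiv_subset ℝ).trans φ_ball
  obtain ⟨B, hB⟩ := φ_supp.exists_bound_of_continuous hφ.continuous
  obtain ⟨B', hB'⟩ := (φ_supp.fderiv ℝ).exists_bound_of_continuous hφ'
  choose p hp using fun k => exists_polynomial_eq_peakAverage (ρ + a) k hφ.continuous φ_supp
  have fderiv_eval_p (k x) :
      fderiv ℝ (fun z => eval z (p k)) x = peakAverage (ρ + a) k (fderiv ℝ φ) x := by
    rw [funext (hp k)]
    exact (hasFDerivAt_peakAverage _ k hφ φ_supp x).fderiv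
  have norm_add_le : ∀ x ∈ K, ‖x‖ + a ≤ ρ + a := fun x hx => by gcongr; exact hρ x hx
  have S_pos : 0 < ρ + a := by positivity
  refine ⟨p, fun x hx => ?_, fun x hx => ?_, max B B', fun k x hx => ⟨?_, ?_⟩⟩
  · simpa only [hp] using tendsto_peakAverage S_pos hφ.continuous φ_support (norm_add_le x hx)
  · simpa only [fderiv_eval_p] using tendsto_peakAverage S_pos hφ' φ'_support (norm_add_le x hx)
  · rw [hp]
    exact (norm_peakAverage_le hB φ_support (norm_add_le x hx) k).trans (le_max_left _ _)
  · rw [fderiv_eval_p]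
    exact (norm_peakAverage_le hB' φ'_support (norm_add_le x hx) k).trans (le_max_right _ _)

theorem exists_hasCompactSupport_eventuallyEq {v : (Fin n → ℝ) → ℝ} (hv : ContDiff ℝ 1 v)
    {K : Set (Fin n → ℝ)} (hK : Bornology.IsBounded K) :
    ∃ φ, ContDiff ℝ 1 φ ∧ HasCompactSupport φ ∧ ∀ x ∈ K, φ =ᶠ[𝓝 x] v := by
  obtain ⟨ρ, ρ_pos, hρ⟩ := hK.exists_pos_norm_le
  let χ : ContDiffBump (0 : Fin n → ℝ) := ⟨ρ + 1, ρ + 2, by linarith, by linarith⟩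
  refine ⟨fun x => χ x * v x, χ.contDiff.mul hv, χ.hasCompactSupport.mul_right, fun x hx => ?_⟩
  have mem_ball : x ∈ Metric.ball 0 χ.rIn :=
    mem_ball_zero_iff.2 ((hρ x hx).trans_lt (lt_add_one ρ))
  filter_upwards [χ.eventuallyEq_one_of_mem_ball mem_ball] with y hy
  rw [hy, Pi.one_apply, one_mul]

theorem exists_boundedlyApproximates {v : (Fin n → ℝ) → ℝ} (hv : ContDiff ℝ 1 v)
    {K : Set (Fin n → ℝ)} (hK : Bornology.IsBounded K) : ∃ p, BoundedlyApproximates p v K := by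
  obtain ⟨φ, hφ, φ_supp, φ_eq⟩ := exists_hasCompactSupport_eventuallyEq hv hK
  obtain ⟨p, hp⟩ := exists_boundedlyApproximates_of_hasCompactSupport hφ φ_supp hK
  exact ⟨p, hp.congr φ_eq⟩

end Approximation

section Derivative

variable {σ : Type*} [Fintype σ]

theorem hasFDerivAt_eval (p : MvPolynomial σ ℝ) (x : σ → ℝ) :
    HasFDerivAt (fun z => eval z p)
      (∑ i, eval x (pderiv i p) • ContinuousLinearMap.proj (R := ℝ) (φ := fun _ : σ => ℝ) i) x := by
  classical
  induction p using MvPolynomial.induction_on with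
  | C a => simpa using hasFDerivAt_const a x
  | add p q hp hq =>
    simp only [map_add, add_smul, Finset.sum_add_distrib]
    exact hp.add hq
  | mul_X p j hp =>
    simp only [map_mul, eval_X]
    convert! hp.mul (hasFDerivAt_apply j x) using 1
    ext t
    simp only [Derivation.leibniz, smul_eq_mul, map_add, map_mul, eval_X, pderiv_X, add_smul,
      Finset.sum_add_distrib, add_apply, sum_apply, smul_apply, ContinuousLinearMap.proj_apply,
      Finset.mul_sum]
    congr 1
    · simp [Pi.single_apply, apply_ite]
    · exact Finset.sum_congr rfl fun i _ => by ring

theorem fderiv_eval_apply (p : MvPolynomial σ ℝ) (x h : σ → ℝ) :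
    fderiv ℝ (fun z => eval z p) x h = ∑ i, eval x (pderiv i p) * h i := by
  simp [(hasFDerivAt_eval p x).fderiv]

theorem contDiff_eval (p : MvPolynomial σ ℝ) : ContDiff ℝ 1 fun z : σ → ℝ => eval z p :=
  contDiffOn_univ.1 ((AnalyticOnNhd.eval_mvPolynomial p).contDiffOn uniqueDiffOn_univ)

end Derivative

section Limits

variable {n : ℕ} {Z : Type*} [MeasurableSpace Z] {μ : Measure Z} {p : ℕ → MvPolynomial (Fin n) ℝ}
  {v : (Fin n → ℝ) → ℝ} {K : Set (Fin n → ℝ)} {π : Z → Fin n → ℝ}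

theorem BoundedlyApproximates.tendsto_integral [IsFiniteMeasure μ]
    (hp : BoundedlyApproximates p v K) (hπ : Measurable π) (hμ : ∀ᵐ z ∂μ, π z ∈ K) :
    Tendsto (fun k => ∫ z, eval (π z) (p k) ∂μ) atTop (𝓝 (∫ z, v (π z) ∂μ)) := by
  obtain ⟨B, hB⟩ := hp.exists_bound
  exact tendsto_integral_of_dominated_convergence (fun _ => B)
    (fun k => ((continuous_eval (p k)).measurable.comp hπ).aestronglyMeasurable)
    (integrable_const B) (fun k => hμ.mono fun z hz => (hB k _ hz).1)
    (hμ.mono fun z hz => hp.tendsto_eval _ hz)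

theorem BoundedlyApproximates.tendsto_integral_fderiv (hp : BoundedlyApproximates p v K)
    (hπ : Measurable π) (hμ : ∀ᵐ z ∂μ, π z ∈ K) {F : Z → Fin n → ℝ} (hF : Integrable F μ) :
    Tendsto (fun k => ∫ z, fderiv ℝ (fun x => eval x (p k)) (π z) (F z) ∂μ) atTop
      (𝓝 (∫ z, fderiv ℝ v (π z) (F z) ∂μ)) := by
  obtain ⟨B, hB⟩ := hp.exists_bound
  refine tendsto_integral_of_dominated_convergence (fun z => B * ‖F z‖) (fun k => ?_)
    (hF.norm.const_mul B)
    (fun k => hμ.mono fun z hz => ContinuousLinearMap.le_of_opNorm_le _ (hB k _ hz).2 _)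
    (hμ.mono fun z hz => ((ContinuousLinearMap.apply ℝ ℝ (F z)).continuous.tendsto _).comp
      (hp.tendsto_fderiv _ hz))
  have fderiv_continuous := (contDiff_eval (p k)).continuous_fderiv one_ne_zero
  exact (ContinuousLinearMap.id ℝ ((Fin n → ℝ) →L[ℝ] ℝ)).aestronglyMeasurable_comp₂
    (fderiv_continuous.measurable.comp hπ).aestronglyMeasurable hF.aestronglyMeasurable

end Limits

/-! ### Feasible points of the infinite-dimensional programs -/

section LebesgueSplit

variable {n : ℕ} {K : Set (Fin n → ℝ)} {μ₀ μ₀' : Measure (Fin n → ℝ)}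

theorem lebesgueSplit_of_integral_eval [IsFiniteMeasure μ₀] [IsFiniteMeasure μ₀']
    (hK : IsCompact K) (hμ₀ : ∀ᵐ x ∂μ₀, x ∈ K) (hμ₀' : ∀ᵐ x ∂μ₀', x ∈ K)
    (split : ∀ p, ∫ x, eval x p ∂μ₀ + ∫ x, eval x p ∂μ₀' = ∫ x in K, eval x p) :
    LebesgueSplit K μ₀ μ₀' := by
  refine ⟨inferInstance, inferInstance, Measure.support_subset_of_isClosed hK.isClosed hμ₀,
    Measure.support_subset_of_isClosed hK.isClosed hμ₀', fun w hw => ?_⟩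
  obtain ⟨p, hp⟩ := exists_polynomial_tendstoUniformlyOn hK hw
  have : Fact (volume K < ⊤) := ⟨hK.measure_lt_top⟩
  have tendsto_integral (ν : Measure (Fin n → ℝ)) [IsFiniteMeasure ν] (hν : ∀ᵐ x ∂ν, x ∈ K) :
      Tendsto (fun k => ∫ x, eval x (p k) ∂ν) atTop (𝓝 (∫ x, w x ∂ν)) :=
    tendsto_integral_of_tendstoUniformlyOn hK hν (fun k => (continuous_eval _).continuousOn) hw hp
  refine tendsto_nhds_unique ?_
    (tendsto_integral (volume.restrict K) (ae_restrict_mem hK.measurableSet))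
  simpa only [split] using (tendsto_integral μ₀ hμ₀).add (tendsto_integral μ₀' hμ₀')

theorem LebesgueSplit.measureReal_le (h : LebesgueSplit K μ₀ μ₀') (hK : IsCompact K)
    {v w : (Fin n → ℝ) → ℝ} (hv : ContinuousOn v K) (hw : ContinuousOn w K)
    (v_add_one_le : ∀ x ∈ K, v x + 1 ≤ w x) (w_nonneg : ∀ x ∈ K, 0 ≤ w x)
    (integral_nonneg : 0 ≤ ∫ x, v x ∂μ₀) : μ₀.real K ≤ ∫ x in K, w x := by
  obtain ⟨_, _, supp, supp', split⟩ := h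
  have mem_K : ∀ᵐ x ∂μ₀, x ∈ K := mem_of_superset Measure.support_mem_ae supp
  have mem_K' : ∀ᵐ x ∂μ₀', x ∈ K := mem_of_superset Measure.support_mem_ae supp'
  have v_integrable := integrable_of_continuousOn_compact hK mem_K hv
  calc μ₀.real K
      ≤ μ₀.real Set.univ := measureReal_mono (Set.subset_univ K)
    _ ≤ ∫ x, v x ∂μ₀ + μ₀.real Set.univ := le_add_of_nonneg_left integral_nonneg
    _ = ∫ x, (v x + 1) ∂μ₀ := by rw [integral_add v_integrable (integrable_const 1)]; simp
    _ ≤ ∫ x, w x ∂μ₀ := integral_mono_ae (v_integrable.add (integrable_const 1))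
        (integrable_of_continuousOn_compact hK mem_K hw) (mem_K.mono v_add_one_le)
    _ ≤ ∫ x, w x ∂μ₀ + ∫ x, w x ∂μ₀' :=
        le_add_of_nonneg_right (integral_nonneg_of_ae (mem_K'.mono w_nonneg))
    _ = ∫ x in K, w x := split w hw

end LebesgueSplit

section Product

variable {n m nX nU : ℕ} {gX : Fin nX → MvPolynomial (Fin n) ℝ}
  {gU : Fin nU → MvPolynomial (Fin m) ℝ}

theorem continuous_sumElim {ι κ : Type*} :
    Continuous fun z : (ι → ℝ) × (κ → ℝ) => (Sum.elim z.1 z.2 : ι ⊕ κ → ℝ) :=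
  Homeomorph.sumArrowHomeomorphProdArrow.symm.continuous

theorem sumElim_mem_semialgSet_productConstraints {x : Fin n → ℝ} {u : Fin m → ℝ} :
    Sum.elim x u ∈ semialgSet (productConstraints gX gU) ↔
      x ∈ semialgSet gX ∧ u ∈ semialgSet gU := by
  simp [semialgSet, productConstraints, Sum.forall, eval_rename]

theorem exists_measure_prod (hg : BoundsCoordinates (productConstraints gX gU))
    {L : MvPolynomial (Fin n ⊕ Fin m) ℝ →ₗ[ℝ] ℝ}
    (hL : ∀ q ∈ quadraticModule (productConstraints gX gU), 0 ≤ L q) :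
    ∃ μ : Measure ((Fin n → ℝ) × (Fin m → ℝ)), IsFiniteMeasure μ ∧
      (∀ᵐ z ∂μ, z ∈ semialgSet gX ×ˢ semialgSet gU) ∧
      ∀ p, L p = ∫ z, eval (Sum.elim z.1 z.2) p ∂μ := by
  obtain ⟨ν, hν_finite, hν_mem, hν⟩ := hg.exists_measure hL
  let e := Homeomorph.sumArrowHomeomorphProdArrow (ι := Fin n) (ι' := Fin m) (X := ℝ)
  have sumElim_e (z) : Sum.elim (e z).1 (e z).2 = z := e.symm_apply_apply z
  refine ⟨ν.map e, inferInstance, ?_, fun p => ?_⟩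
  · refine (ae_map_iff e.measurable.aemeasurable
      ((isClosed_semialgSet gX).prod (isClosed_semialgSet gU)).measurableSet).2 ?_
    exact hν_mem.mono fun z hz =>
      sumElim_mem_semialgSet_productConstraints.1 ((sumElim_e z).symm ▸ hz)
  · rw [hν, e.measurableEmbedding.integral_map]
    simp only [sumElim_e]

variable {A : MvPolynomial (Fin n) ℝ → MvPolynomial (Fin n ⊕ Fin m) ℝ}

theorem exists_eval_nonneg_of_mem_dualPolynomialValues {c : ℝ}
    (hc : c ∈ dualPolynomialValues A gX gU) :
    ∃ v w : MvPolynomial (Fin n) ℝ,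
      (∀ x ∈ semialgSet gX, ∀ u ∈ semialgSet gU, 0 ≤ eval (Sum.elim x u) (A v)) ∧
      (∀ x ∈ semialgSet gX, eval x v + 1 ≤ eval x w) ∧ (∀ x ∈ semialgSet gX, 0 ≤ eval x w) ∧
      c = ∫ x in semialgSet gX, eval x w := by
  obtain ⟨v, w, decay, super, nonneg, rfl⟩ := hc
  refine ⟨v, w, fun x hx u hu => eval_nonneg_of_mem_quadraticModule decay
    (sumElim_mem_semialgSet_productConstraints.2 ⟨hx, hu⟩), fun x hx => ?_,
    fun x hx => eval_nonneg_of_mem_quadraticModule nonneg hx, rfl⟩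
  have := eval_nonneg_of_mem_quadraticModule super hx
  simp only [map_sub, map_one] at this
  linarith

theorem AreFeasibleFunctionals.exists_measures {L : MvPolynomial (Fin n ⊕ Fin m) ℝ →ₗ[ℝ] ℝ}
    {L₀ L₀' : MvPolynomial (Fin n) ℝ →ₗ[ℝ] ℝ} (hL : AreFeasibleFunctionals A gX gU L L₀ L₀')
    (hX : HasBallCover gX) (hU : HasBallCover gU) :
    ∃ (μ : Measure ((Fin n → ℝ) × (Fin m → ℝ))) (μ₀ μ₀' : Measure (Fin n → ℝ)),
      IsFiniteMeasure μ ∧ μ.support ⊆ semialgSet gX ×ˢ semialgSet gU ∧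
      LebesgueSplit (semialgSet gX) μ₀ μ₀' ∧
      (∀ v, ∫ z, eval (Sum.elim z.1 z.2) (A v) ∂μ = ∫ x, eval x v ∂μ₀) ∧
      L₀ 1 = μ₀.real (semialgSet gX) := by
  obtain ⟨μ, hμ_finite, hμ_mem, hμ⟩ :=
    exists_measure_prod (hX.productConstraints hU).boundsCoordinates hL.nonneg
  obtain ⟨μ₀, _, hμ₀_mem, hμ₀⟩ := hX.boundsCoordinates.exists_measure hL.nonneg_initial
  obtain ⟨μ₀', _, hμ₀'_mem, hμ₀'⟩ := hX.boundsCoordinates.exists_measure hL.nonneg_slack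
  refine ⟨μ, μ₀, μ₀', hμ_finite, Measure.support_subset_of_isClosed
    ((isClosed_semialgSet gX).prod (isClosed_semialgSet gU)) hμ_mem,
    lebesgueSplit_of_integral_eval hX.boundsCoordinates.isCompact hμ₀_mem hμ₀'_mem fun w => ?_,
    fun v => ?_, ?_⟩
  · rw [← hμ₀, ← hμ₀', hL.split]
  · rw [← hμ, ← hμ₀, hL.dynamics]
  · have mass : μ₀.real (semialgSet gX) = μ₀.real Set.univ :=
      measureReal_congr (eventuallyEq_univ.2 hμ₀_mem)
    rw [hμ₀, mass]
    simp

end Product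

/-! ### Discrete and continuous dynamics -/

section Dynamics

variable {n m nX nU : ℕ} {f : Fin n → MvPolynomial (Fin n ⊕ Fin m) ℝ}

theorem continuous_evalField :
    Continuous fun z : (Fin n → ℝ) × (Fin m → ℝ) => evalField f z.1 z.2 :=
  continuous_pi fun i => (continuous_eval (f i)).comp continuous_sumElim

theorem continuous_fderiv_evalField {v : (Fin n → ℝ) → ℝ} (hv : ContDiff ℝ 1 v) :
    Continuous fun z : (Fin n → ℝ) × (Fin m → ℝ) => fderiv ℝ v z.1 (evalField f z.1 z.2) :=
  ((hv.continuous_fderiv one_ne_zero).comp continuous_fst).clm_apply continuous_evalField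

theorem eval_discreteOp (α : ℝ) (v : MvPolynomial (Fin n) ℝ) (x : Fin n → ℝ) (u : Fin m → ℝ) :
    eval (Sum.elim x u) (discreteOp f α v) = eval x v - α * eval (evalField f x u) v := by
  have eval_bind₁ : eval (Sum.elim x u) (bind₁ f v) = eval (evalField f x u) v :=
    eval₂Hom_bind₁ _ _ _ _
  simp [discreteOp, eval_bind₁, eval_rename]

theorem eval_continuousOp (β : ℝ) (v : MvPolynomial (Fin n) ℝ) (x : Fin n → ℝ) (u : Fin m → ℝ) :
    eval (Sum.elim x u) (continuousOp f β v) =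
      β * eval x v - fderiv ℝ (fun z => eval z v) x (evalField f x u) := by
  simp [continuousOp, fderiv_eval_apply, eval_rename, evalField]

/-- `discreteOp` bundled as a linear map, the form in which the abstract duality argument takes
the operator of the dynamics constraint. -/
def discreteOpLinear (f : Fin n → MvPolynomial (Fin n ⊕ Fin m) ℝ) (α : ℝ) :
    MvPolynomial (Fin n) ℝ →ₗ[ℝ] MvPolynomial (Fin n ⊕ Fin m) ℝ where
  toFun := discreteOp f α
  map_add' v w := by simp only [discreteOp, map_add]; ring
  map_smul' c v := by
    simp only [discreteOp, smul_eq_C_mul, map_mul, rename_C, bind₁_C_right, RingHom.id_apply]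
    ring

/-- `continuousOp` bundled as a linear map, see `discreteOpLinear`. -/
def continuousOpLinear (f : Fin n → MvPolynomial (Fin n ⊕ Fin m) ℝ) (β : ℝ) :
    MvPolynomial (Fin n) ℝ →ₗ[ℝ] MvPolynomial (Fin n ⊕ Fin m) ℝ where
  toFun := continuousOp f β
  map_add' v w := by simp only [continuousOp, map_add, add_mul, Finset.sum_add_distrib]; ring
  map_smul' c v := by
    simp only [continuousOp, smul_eq_C_mul, map_mul, rename_C, pderiv_C_mul, RingHom.id_apply,
      mul_assoc, ← Finset.mul_sum]
    ring

theorem discreteOpLinear_one (α : ℝ) : discreteOpLinear f α 1 = C (1 - α) := by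
  simp [discreteOpLinear, discreteOp]

theorem continuousOpLinear_one (β : ℝ) : continuousOpLinear f β 1 = C β := by
  simp [continuousOpLinear, continuousOp]

section WeakDuality

variable {K : Set (Fin n → ℝ)} {U : Set (Fin m → ℝ)}

theorem le_of_mem_discretePrimalValues (hK : IsCompact K) (hU : IsCompact U) {α p d : ℝ}
    (hp : p ∈ discretePrimalValues f K U α) (hd : d ∈ discreteDualValues f K U α) : p ≤ d := by
  obtain ⟨μ, μ₀, μ₀', _, supp, split, dynamics, rfl⟩ := hp
  obtain ⟨v, w, hv, hw, decay, v_add_one_le, w_nonneg, rfl⟩ := hd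
  refine split.measureReal_le hK hv.continuousOn hw v_add_one_le w_nonneg ?_
  have mem_KU : ∀ᵐ z ∂μ, z ∈ K ×ˢ U := mem_of_superset Measure.support_mem_ae supp
  have integral_le : ∫ z, α * v (evalField f z.1 z.2) ∂μ ≤ ∫ z, v z.1 ∂μ :=
    integral_mono_ae
      ((integrable_of_continuousOn_compact (hK.prod hU) mem_KU
        (hv.comp continuous_evalField).continuousOn).const_mul α)
      (integrable_of_continuousOn_compact (hK.prod hU) mem_KU (hv.comp continuous_fst).continuousOn)
      (mem_KU.mono fun z hz => decay z.1 hz.1 z.2 hz.2)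
  rw [integral_const_mul, dynamics v hv] at integral_le
  exact le_add_iff_nonneg_left _ |>.1 integral_le

theorem le_of_mem_continuousPrimalValues (hK : IsCompact K) (hU : IsCompact U) {β p d : ℝ}
    (hp : p ∈ continuousPrimalValues f K U β) (hd : d ∈ continuousDualValues f K U β) :
    p ≤ d := by
  obtain ⟨μ, μ₀, μ₀', _, supp, split, dynamics, rfl⟩ := hp
  obtain ⟨v, w, hv, hw, decay, v_add_one_le, w_nonneg, rfl⟩ := hd
  refine split.measureReal_le hK hv.continuous.continuousOn hw v_add_one_le w_nonneg ?_
  have mem_KU : ∀ᵐ z ∂μ, z ∈ K ×ˢ U := mem_of_superset Measure.support_mem_ae supp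
  have integral_le :
      ∫ z, fderiv ℝ v z.1 (evalField f z.1 z.2) ∂μ ≤ ∫ z, β * v z.1 ∂μ :=
    integral_mono_ae
      (integrable_of_continuousOn_compact (hK.prod hU) mem_KU
        (continuous_fderiv_evalField hv).continuousOn)
      ((integrable_of_continuousOn_compact (hK.prod hU) mem_KU
        (hv.continuous.comp continuous_fst).continuousOn).const_mul β)
      (mem_KU.mono fun z hz => decay z.1 hz.1 z.2 hz.2)
  rw [integral_const_mul, dynamics v hv] at integral_le
  exact le_add_iff_nonneg_left _ |>.1 integral_le

end WeakDuality

section PolynomialTestFunctions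

variable {K : Set (Fin n → ℝ)} {U : Set (Fin m → ℝ)} {μ : Measure ((Fin n → ℝ) × (Fin m → ℝ))}
  [IsFiniteMeasure μ] {μ₀ : Measure (Fin n → ℝ)} [IsFiniteMeasure μ₀]

theorem integral_eq_of_integral_eval_discreteOp (hK : IsCompact K) (hU : IsCompact U)
    (hμ : ∀ᵐ z ∂μ, z ∈ K ×ˢ U) (hμ₀ : ∀ᵐ x ∂μ₀, x ∈ K) {α : ℝ}
    (h : ∀ p, ∫ z, eval (Sum.elim z.1 z.2) (discreteOp f α p) ∂μ = ∫ x, eval x p ∂μ₀)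
    {v : (Fin n → ℝ) → ℝ} (hv : Continuous v) :
    ∫ z, v z.1 ∂μ = ∫ x, v x ∂μ₀ + α * ∫ z, v (evalField f z.1 z.2) ∂μ := by
  have hKU := hK.prod hU
  have polynomial_identity (p : MvPolynomial (Fin n) ℝ) : ∫ z, eval z.1 p ∂μ =
      ∫ x, eval x p ∂μ₀ + α * ∫ z, eval (evalField f z.1 z.2) p ∂μ := by
    rw [← h, ← integral_const_mul, ← integral_add]
    · simp only [eval_discreteOp, sub_add_cancel]
    · exact integrable_of_continuousOn_compact hKU hμ
        ((continuous_eval _).comp continuous_sumElim).continuousOn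
    · exact (integrable_of_continuousOn_compact hKU hμ
        ((continuous_eval p).comp continuous_evalField).continuousOn).const_mul α
  obtain ⟨T, hT, K_subset_T, mapsTo_T⟩ : ∃ T, IsCompact T ∧ K ⊆ T ∧
      Set.MapsTo (fun z : (Fin n → ℝ) × (Fin m → ℝ) => evalField f z.1 z.2) (K ×ˢ U) T :=
    ⟨_, hK.union (hKU.image continuous_evalField), Set.subset_union_left,
      fun _ hz => .inr (Set.mem_image_of_mem _ hz)⟩
  obtain ⟨p, hp⟩ := exists_polynomial_tendstoUniformlyOn hT hv.continuousOn
  have tendsto_integral_comp {π : (Fin n → ℝ) × (Fin m → ℝ) → Fin n → ℝ} (hπ : Continuous π)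
      (hπ_mem : Set.MapsTo π (K ×ˢ U) T) :
      Tendsto (fun k => ∫ z, eval (π z) (p k) ∂μ) atTop (𝓝 (∫ z, v (π z) ∂μ)) :=
    tendsto_integral_of_tendstoUniformlyOn hKU hμ
      (fun k => ((continuous_eval (p k)).comp hπ).continuousOn) (hv.comp hπ).continuousOn
      ((hp.comp π).mono hπ_mem)
  have tendsto_initial := tendsto_integral_of_tendstoUniformlyOn hK hμ₀
    (fun k => (continuous_eval (p k)).continuousOn) hv.continuousOn (hp.mono K_subset_T)
  have tendsto_state := tendsto_integral_comp continuous_fst fun _ hz => K_subset_T hz.1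
  have tendsto_next := tendsto_integral_comp continuous_evalField mapsTo_T
  simp only [polynomial_identity] at tendsto_state
  exact tendsto_nhds_unique tendsto_state (tendsto_initial.add (tendsto_next.const_mul α))

theorem integral_eq_of_integral_eval_continuousOp (hK : IsCompact K) (hU : IsCompact U)
    (hμ : ∀ᵐ z ∂μ, z ∈ K ×ˢ U) (hμ₀ : ∀ᵐ x ∂μ₀, x ∈ K) {β : ℝ}
    (h : ∀ p, ∫ z, eval (Sum.elim z.1 z.2) (continuousOp f β p) ∂μ = ∫ x, eval x p ∂μ₀)
    {v : (Fin n → ℝ) → ℝ} (hv : ContDiff ℝ 1 v) :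
    β * ∫ z, v z.1 ∂μ = ∫ x, v x ∂μ₀ + ∫ z, fderiv ℝ v z.1 (evalField f z.1 z.2) ∂μ := by
  have hKU := hK.prod hU
  have polynomial_identity (p : MvPolynomial (Fin n) ℝ) : β * ∫ z, eval z.1 p ∂μ =
      ∫ x, eval x p ∂μ₀ +
        ∫ z, fderiv ℝ (fun x => eval x p) z.1 (evalField f z.1 z.2) ∂μ := by
    rw [← h, ← integral_const_mul, ← integral_add]
    · simp only [eval_continuousOp, sub_add_cancel]
    · exact integrable_of_continuousOn_compact hKU hμ
        ((continuous_eval _).comp continuous_sumElim).continuousOn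
    · exact integrable_of_continuousOn_compact hKU hμ
        (continuous_fderiv_evalField (contDiff_eval p)).continuousOn
  obtain ⟨p, hp⟩ := exists_boundedlyApproximates hv hK.isBounded
  have hμ_state : ∀ᵐ z ∂μ, z.1 ∈ K := hμ.mono fun _ hz => hz.1
  have tendsto_state := (hp.tendsto_integral measurable_fst hμ_state).const_mul β
  have tendsto_initial := hp.tendsto_integral measurable_id hμ₀
  have tendsto_flow := hp.tendsto_integral_fderiv measurable_fst hμ_state
    (integrable_of_continuousOn_compact hKU hμ (continuous_evalField (f := f)).continuousOn)
  simp only [polynomial_identity] at tendsto_state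
  exact tendsto_nhds_unique tendsto_state (tendsto_initial.add tendsto_flow)

end PolynomialTestFunctions

variable {gX : Fin nX → MvPolynomial (Fin n) ℝ} {gU : Fin nU → MvPolynomial (Fin m) ℝ}

theorem dualPolynomialValues_subset_discreteDualValues (α : ℝ) :
    dualPolynomialValues (discreteOpLinear f α) gX gU ⊆
      discreteDualValues f (semialgSet gX) (semialgSet gU) α := by
  intro c hc
  obtain ⟨v, w, decay, v_add_one_le, w_nonneg, rfl⟩ :=
    exists_eval_nonneg_of_mem_dualPolynomialValues hc
  exact ⟨fun x => eval x v, fun x => eval x w, continuous_eval v, (continuous_eval w).continuousOn,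
    fun x hx u hu => sub_nonneg.1 ((decay x hx u hu).trans_eq (eval_discreteOp α v x u)),
    v_add_one_le, w_nonneg, rfl⟩

theorem dualPolynomialValues_subset_continuousDualValues (β : ℝ) :
    dualPolynomialValues (continuousOpLinear f β) gX gU ⊆
      continuousDualValues f (semialgSet gX) (semialgSet gU) β := by
  intro c hc
  obtain ⟨v, w, decay, v_add_one_le, w_nonneg, rfl⟩ :=
    exists_eval_nonneg_of_mem_dualPolynomialValues hc
  exact ⟨fun x => eval x v, fun x => eval x w, contDiff_eval v, (continuous_eval w).continuousOn,
    fun x hx u hu => sub_nonneg.1 ((decay x hx u hu).trans_eq (eval_continuousOp β v x u)),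
    v_add_one_le, w_nonneg, rfl⟩

variable {L : MvPolynomial (Fin n ⊕ Fin m) ℝ →ₗ[ℝ] ℝ} {L₀ L₀' : MvPolynomial (Fin n) ℝ →ₗ[ℝ] ℝ}

theorem AreFeasibleFunctionals.mem_discretePrimalValues {α : ℝ}
    (hL : AreFeasibleFunctionals (discreteOpLinear f α) gX gU L L₀ L₀') (hX : HasBallCover gX)
    (hU : HasBallCover gU) :
    L₀ 1 ∈ discretePrimalValues f (semialgSet gX) (semialgSet gU) α := by
  obtain ⟨μ, μ₀, μ₀', _, supp, split, dynamics, mass⟩ := hL.exists_measures hX hU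
  have : IsFiniteMeasure μ₀ := split.1
  exact ⟨μ, μ₀, μ₀', inferInstance, supp, split, fun v hv =>
    integral_eq_of_integral_eval_discreteOp hX.boundsCoordinates.isCompact
      hU.boundsCoordinates.isCompact (mem_of_superset Measure.support_mem_ae supp)
      (mem_of_superset Measure.support_mem_ae split.2.2.1) dynamics hv, mass⟩

theorem AreFeasibleFunctionals.mem_continuousPrimalValues {β : ℝ}
    (hL : AreFeasibleFunctionals (continuousOpLinear f β) gX gU L L₀ L₀') (hX : HasBallCover gX)
    (hU : HasBallCover gU) :
    L₀ 1 ∈ continuousPrimalValues f (semialgSet gX) (semialgSet gU) β := by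
  obtain ⟨μ, μ₀, μ₀', _, supp, split, dynamics, mass⟩ := hL.exists_measures hX hU
  have : IsFiniteMeasure μ₀ := split.1
  exact ⟨μ, μ₀, μ₀', inferInstance, supp, split, fun v hv =>
    integral_eq_of_integral_eval_continuousOp hX.boundsCoordinates.isCompact
      hU.boundsCoordinates.isCompact (mem_of_superset Measure.support_mem_ae supp)
      (mem_of_superset Measure.support_mem_ae split.2.2.1) dynamics hv, mass⟩

end Dynamics

end MCI

end

theorem mainTheorem5_general {n m nX nU : ℕ} (f : Fin n → MvPolynomial (Fin n ⊕ Fin m) ℝ)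
    (gX : Fin nX → MvPolynomial (Fin n) ℝ) (gU : Fin nU → MvPolynomial (Fin m) ℝ)
    (hX : MCI.HasBallCover gX) (hU : MCI.HasBallCover gU)
    (r : ℕ → ℕ) (hr : Monotone r) (hkr : ∀ k, k ≤ r k) :
    (∀ α : ℝ, α < 1 →
      MCI.ValuesConverge
        (MCI.discreteDualValues f (MCI.semialgSet gX) (MCI.semialgSet gU) α)
        (fun k => MCI.dualApproximationValues (MCI.discreteOp f α) gX gU k (r k))
        (MCI.discretePrimalValues f (MCI.semialgSet gX) (MCI.semialgSet gU) α)
        (fun k => MCI.primalRelaxationValues (MCI.discreteOp f α) gX gU k (r k))) ∧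
    (∀ β : ℝ, 0 < β →
      MCI.ValuesConverge
        (MCI.continuousDualValues f (MCI.semialgSet gX) (MCI.semialgSet gU) β)
        (fun k => MCI.dualApproximationValues (MCI.continuousOp f β) gX gU k (r k))
        (MCI.continuousPrimalValues f (MCI.semialgSet gX) (MCI.semialgSet gU) β)
        (fun k => MCI.primalRelaxationValues (MCI.continuousOp f β) gX gU k (r k))) := by
  have X_compact := hX.boundsCoordinates.isCompact
  have U_compact := hU.boundsCoordinates.isCompact
  refine ⟨fun α hα => ?discrete, fun β hβ => ?continuous⟩
  case discrete =>
    exact MCI.valuesConverge_of_polynomial_feasible hX hU hr hkr (sub_pos.2 hα)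
      (MCI.discreteOpLinear_one α) (MCI.dualPolynomialValues_subset_discreteDualValues α)
      (fun _ _ _ feasible => feasible.mem_discretePrimalValues hX hU)
      (fun _ hp _ hd => MCI.le_of_mem_discretePrimalValues X_compact U_compact hp hd)
  case continuous =>
    exact MCI.valuesConverge_of_polynomial_feasible hX hU hr hkr hβ
      (MCI.continuousOpLinear_one β) (MCI.dualPolynomialValues_subset_continuousDualValues β)
      (fun _ _ _ feasible => feasible.mem_continuousPrimalValues hX hU)
      (fun _ hp _ hd => MCI.le_of_mem_continuousPrimalValues X_compact U_compact hp hd)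

theorem mainTheorem5 {n m nX nU : ℕ} (f : Fin n → MvPolynomial (Fin n ⊕ Fin m) ℝ)
    (gX : Fin nX → MvPolynomial (Fin n) ℝ) (gU : Fin nU → MvPolynomial (Fin m) ℝ)
    (hX : MCI.HasBallConstraint gX) (hU : MCI.HasBallConstraint gU)
    (r : ℕ → ℕ) (hr : Monotone r) (hkr : ∀ k, k ≤ r k) :
    (∀ α : ℝ, 0 < α → α < 1 →
      MCI.ValuesConverge
        (MCI.discreteDualValues f (MCI.semialgSet gX) (MCI.semialgSet gU) α)
        (fun k => MCI.dualApproximationValues (MCI.discreteOp f α) gX gU k (r k))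
        (MCI.discretePrimalValues f (MCI.semialgSet gX) (MCI.semialgSet gU) α)
        (fun k => MCI.primalRelaxationValues (MCI.discreteOp f α) gX gU k (r k))) ∧
    (∀ β : ℝ, 0 < β →
      MCI.ValuesConverge
        (MCI.continuousDualValues f (MCI.semialgSet gX) (MCI.semialgSet gU) β)
        (fun k => MCI.dualApproximationValues (MCI.continuousOp f β) gX gU k (r k))
        (MCI.continuousPrimalValues f (MCI.semialgSet gX) (MCI.semialgSet gU) β)
        (fun k => MCI.primalRelaxationValues (MCI.continuousOp f β) gX gU k (r k))) := by
  let ⟨discrete, continuous⟩ :=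
    mainTheorem5_general f gX gU hX.hasBallCover hU.hasBallCover r hr hkr
  exact ⟨fun α _ => discrete α, continuous⟩
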